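/- An FB-module $W=(W_m)_{m\ge 0}$ is a family in which $W_m$ is a finite-dimensional linear representation over $\mathbb{Q}$ of the symmetric group $S_m$. For a partition $\mu$ of $m$, let $V_\mu$ denote the simple $\mathbb{Q}[S_m]$-module associated with $\mu$. For a (possibly empty) partition $\lambda=(\lambda_1\ge\dots\ge\lambda_\ell)$ and $m\ge|\lambda|+\lambda_1$ (with $\lambda_1=0$ if $\lambda$ is empty), put $\lambda[m]=(m-|\lambda|\ge\lambda_1\ge\dots\ge\lambda_\ell)$, a partition of $m$. $W$ is representation stable (RS) for $m\ge N$ if there are natural numbers $n_\lambda$, indexed by the partitions $\lambda$ with $|\lambda|+\lambda_1\le N$ and independent of $m$, such that $$W_m\;\cong\;\bigoplus_{|\lambda|+\lambda_1\le N}V_{\lambda[m]}^{\,n_\lambda}\qquad\text{for all } m\ge N.$$ $W$ is (RS) if it is so for some $N\in\mathbb{N}$; the smallest such $N$ is $\mathrm{rank}_{\mathrm{RS}}(W)$. A polynomial $P\in\mathbb{Q}[X_1,X_2,\dots]$ expresses the character of $W$ for $m\ge N$ if $\chi_{W_m}(g)=P(X_1(g),X_2(g),\dots)$ for all $m\ge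 N$ and $g\in S_m$, where $X_i(g)$ is the number of cycles of length $i$ of $g$ (fixed points being the cycles of length $1$). $W$ has a polynomial character (PC) if such $P$ and $N$ exist; $P$ is then called the polynomial character $P_W$ of $W$, and the smallest $N$ for which such a $P$ exists is $\mathrm{rank}_{\mathrm{PC}}(W)$. Let $\deg_w$ be the degree on $\mathbb{Q}[X_1,X_2,\dots]$ for which $\deg_w(X_i)=i$ (with $\deg_w(0)=0$). **Theorem.** Let $W$ be an FB-module. (a) If $W$ is (RS), then $W$ is (PC) and $\mathrm{rank}_{\mathrm{PC}}(W)\le\mathrm{rank}_{\mathrm{RS}}(W)$. (b) If $W$ is (PC) with polynomial character $P_W$, then $W$ is (RS) and $\mathrm{rank}_{\mathrm{RS}}(W)\le\max\{\mathrm{rank}_{\mathrm{PC}}(W),\,2\deg_w(P_W)\}$. -/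

import Mathlib

universe u

/-- A finite-dimensional representation over `ℚ` of each symmetric group `S_m = Perm (Fin m)`,
`m = 0, 1, 2, …`. -/
structure FBModule where
  /-- the underlying vector space `W_m` -/
  V : ℕ → Type u
  [addCommGroup : ∀ m, AddCommGroup (V m)]
  [module : ∀ m, Module ℚ (V m)]
  [finiteDimensional : ∀ m, FiniteDimensional ℚ (V m)]
  /-- the action of `S_m` on `W_m` -/
  ρ : ∀ m, Representation ℚ (Equiv.Perm (Fin m)) (V m)

attribute [instance] FBModule.addCommGroup FBModule.module FBModule.finiteDimensional

/-! ### The simple modules of the symmetric groups -/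

namespace SymmetricRep

/-- The rational group algebra `ℚ[S_m]`. -/
abbrev GroupAlg (m : ℕ) : Type := MonoidAlgebra ℚ (Equiv.Perm (Fin m))

/-- A Young tableau of shape `μ`: a numbering of the cells of `μ` by `Fin m`. The numbering is
arbitrary; another one conjugates the Young symmetrizer and gives an isomorphic module. -/
noncomputable def tableau (μ : YoungDiagram) {m : ℕ} (h : μ.card = m) :
    Fin m ≃ {c : ℕ × ℕ // c ∈ μ.cells} :=
  (Finset.equivFinOfCardEq h).symm

/-- The permutations that preserve each row of the tableau of shape `μ`. -/
noncomputable def rowStabilizer (μ : YoungDiagram) {m : ℕ} (h : μ.card = m) :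
    Finset (Equiv.Perm (Fin m)) :=
  Finset.univ.filter fun g => ∀ k, (tableau μ h (g k)).1.1 = (tableau μ h k).1.1

/-- The permutations that preserve each column of the tableau of shape `μ`. -/
noncomputable def colStabilizer (μ : YoungDiagram) {m : ℕ} (h : μ.card = m) :
    Finset (Equiv.Perm (Fin m)) :=
  Finset.univ.filter fun g => ∀ k, (tableau μ h (g k)).1.2 = (tableau μ h k).1.2

/-- The Young symmetrizer `c_μ = (∑_{p preserves rows} p) (∑_{q preserves columns} sgn(q) q)`. -/
noncomputable def youngSymmetrizer (μ : YoungDiagram) {m : ℕ} (h : μ.card = m) : GroupAlg m :=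
  (∑ p ∈ rowStabilizer μ h, MonoidAlgebra.single p (1 : ℚ)) *
    ∑ q ∈ colStabilizer μ h, MonoidAlgebra.single q ((Equiv.Perm.sign q : ℤ) : ℚ)

/-- The simple `S_m`-module `V_μ` associated with a partition `μ` of `m` (given by its Young
diagram): the left ideal `ℚ[S_m] c_μ`. -/
noncomputable def simpleModule (μ : YoungDiagram) {m : ℕ} (h : μ.card = m) :
    Submodule (GroupAlg m) (GroupAlg m) :=
  Submodule.span (GroupAlg m) {youngSymmetrizer μ h}

/-- The Young diagram of `lam[m] = (m - |lam| ≥ lam₁ ≥ … ≥ lam_ℓ)`, defined for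
`m ≥ |lam| + lam₁`: the diagram of `lam` moved down by one row, below a first row with
`m - |lam|` cells. -/
def padded (lam : YoungDiagram) (m : ℕ) (h : lam.card + lam.rowLen 0 ≤ m) : YoungDiagram where
  cells := ({0} ×ˢ Finset.range (m - lam.card)) ∪ lam.cells.image fun c => (c.1 + 1, c.2)
  isLowerSet := by
    rintro ⟨i, j⟩ ⟨i', j'⟩ hle hmem
    obtain ⟨h1, h2⟩ := Prod.mk_le_mk.mp hle
    simp only [Finset.coe_union, Finset.coe_image, Set.mem_union, Finset.mem_coe,
      Finset.mem_product, Finset.mem_singleton, Finset.mem_range, Set.mem_image,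
      Prod.exists, Prod.mk.injEq] at hmem ⊢
    rcases hmem with ⟨hi, hj⟩ | ⟨a, b, hab, ha, hb⟩
    · left
      omega
    · rcases Nat.eq_zero_or_pos i' with h0 | h0
      · left
        have h3 : (0, b) ∈ lam := lam.up_left_mem (Nat.zero_le a) le_rfl hab
        rw [YoungDiagram.mem_iff_lt_rowLen] at h3
        omega
      · right
        exact ⟨i' - 1, j', lam.up_left_mem (by omega) (by omega) hab, by omega, rfl⟩

theorem card_padded (lam : YoungDiagram) (m : ℕ) (h : lam.card + lam.rowLen 0 ≤ m) :
    (padded lam m h).card = m := by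
  change (({0} ×ˢ Finset.range (m - lam.card)) ∪
    lam.cells.image fun c : ℕ × ℕ => (c.1 + 1, c.2)).card = m
  rw [Finset.card_union_of_disjoint, Finset.card_image_of_injective]
  · simp only [Finset.card_product, Finset.card_singleton, Finset.card_range, one_mul]
    change m - lam.card + lam.card = m
    omega
  · rintro ⟨a, b⟩ ⟨c, d⟩ hac
    simp only [Prod.mk.injEq] at hac ⊢
    omega
  · rw [Finset.disjoint_left]
    rintro ⟨a, b⟩ h1 h2
    simp only [Finset.mem_product, Finset.mem_singleton, Finset.mem_image, Prod.mk.injEq] at h1 h2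
    obtain ⟨c, -, hc, -⟩ := h2
    omega

/-- The simple `S_m`-module `V_{lam[m]}`. -/
noncomputable abbrev paddedSimple (lam : YoungDiagram) (m : ℕ)
    (h : lam.card + lam.rowLen 0 ≤ m) : Submodule (GroupAlg m) (GroupAlg m) :=
  simpleModule (padded lam m h) (card_padded lam m h)

/-- `X_i(g)`: the number of `i`-cycles in the decomposition of `g` as a product of disjoint
cycles, the fixed points being the cycles of length `1`. -/
def numCycles {m : ℕ} (g : Equiv.Perm (Fin m)) (i : ℕ+) : ℕ :=
  g.partition.parts.count (i : ℕ)

/-- The degree of a polynomial in `X_1, X_2, …` for which `X_i` has degree `i`. -/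
noncomputable def weight (P : MvPolynomial ℕ+ ℚ) : ℕ :=
  P.weightedTotalDegree fun i : ℕ+ => (i : ℕ)

end SymmetricRep

namespace FBModule

open SymmetricRep DirectSum

/-- `W` is representation stable for `m ≥ N`: there are multiplicities `n_lam`, independent of
`m`, such that for all `m ≥ N` the module `W_m` is isomorphic to the direct sum of the
`V_{lam[m]}^{n_lam}` over the partitions `lam` with `|lam| + lam₁ ≤ N`. -/
def RSFrom (W : FBModule.{u}) (N : ℕ) : Prop :=
  ∃ n : {lam : YoungDiagram // lam.card + lam.rowLen 0 ≤ N} → ℕ, ∀ (m : ℕ) (hm : N ≤ m),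
    Nonempty ((W.ρ m).asModule ≃ₗ[GroupAlg m]
      ⨁ lam : {lam : YoungDiagram // lam.card + lam.rowLen 0 ≤ N},
        (Fin (n lam) → paddedSimple lam.1 m (lam.2.trans hm)))

/-- The polynomial `P` in `X_1, X_2, …` expresses the character of `W_m` for all `m ≥ N`. -/
def CharacterEqFrom (W : FBModule.{u}) (P : MvPolynomial ℕ+ ℚ) (N : ℕ) : Prop :=
  ∀ m : ℕ, N ≤ m → ∀ g : Equiv.Perm (Fin m),
    (W.ρ m).character g = MvPolynomial.eval (fun i => (numCycles g i : ℚ)) P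

/-- `W` has a polynomial character for `m ≥ N`. -/
def PCFrom (W : FBModule.{u}) (N : ℕ) : Prop :=
  ∃ P : MvPolynomial ℕ+ ℚ, W.CharacterEqFrom P N

/-- `P` is a polynomial character of `W`: it expresses the character of `W_m` for all large `m`. -/
def IsPolynomialCharacter (W : FBModule.{u}) (P : MvPolynomial ℕ+ ℚ) : Prop :=
  ∃ N : ℕ, W.CharacterEqFrom P N

/-- `W` is representation stable. -/
def RS (W : FBModule.{u}) : Prop := ∃ N : ℕ, W.RSFrom N

/-- `W` has a polynomial character. -/
def PC (W : FBModule.{u}) : Prop := ∃ N : ℕ, W.PCFrom N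

/-- The smallest `N` such that `W` is representation stable for `m ≥ N` (meaningful if `W` is
representation stable). -/
noncomputable def rankRS (W : FBModule.{u}) : ℕ := sInf {N | W.RSFrom N}

/-- The smallest `N` such that `W` has a polynomial character for `m ≥ N` (meaningful if `W` has a
polynomial character). -/
noncomputable def rankPC (W : FBModule.{u}) : ℕ := sInf {N | W.PCFrom N}

end FBModule

namespace SymmetricRep

/-! ### Group algebras of finite groups -/

section GroupAlgebra

variable {G : Type*} [Group G] [Fintype G]

theorem coeff_mul_eq_sum (x y : MonoidAlgebra ℚ G) (g : G) :
    (x * y).coeff g = ∑ h, x.coeff h * y.coeff (h⁻¹ * g) := by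
  rw [MonoidAlgebra.coeff_mul_apply_left, Finsupp.sum_fintype]
  simp

theorem eq_sum_single (x : MonoidAlgebra ℚ G) :
    x = ∑ g, x.coeff g • MonoidAlgebra.single g (1 : ℚ) := by
  classical
  ext g
  simp [MonoidAlgebra.coeff_sum]

/-- The anti-involution of the group algebra given by inversion. -/
noncomputable def inversion : MonoidAlgebra ℚ G →ₗ[ℚ] MonoidAlgebra ℚ G where
  toFun x := ∑ g, x.coeff g • MonoidAlgebra.single g⁻¹ (1 : ℚ)
  map_add' x y := by simp [add_smul, Finset.sum_add_distrib]
  map_smul' a x := by simp [Finset.smul_sum]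

theorem coeff_inversion (x : MonoidAlgebra ℚ G) (g : G) :
    (inversion x).coeff g = x.coeff g⁻¹ := by
  classical
  simp [inversion, MonoidAlgebra.coeff_sum, Finsupp.single_apply, inv_eq_iff_eq_inv]

theorem inversion_inversion (x : MonoidAlgebra ℚ G) : inversion (inversion x) = x := by
  ext g
  simp [coeff_inversion]

theorem inversion_mul (x y : MonoidAlgebra ℚ G) :
    inversion (x * y) = inversion y * inversion x := by
  ext g
  rw [coeff_inversion, coeff_mul_eq_sum, coeff_mul_eq_sum]
  refine Fintype.sum_equiv (Equiv.mulLeft g) _ _ fun h => ?_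
  simp [coeff_inversion, mul_comm]

theorem inversion_single (g : G) (a : ℚ) :
    inversion (MonoidAlgebra.single g a) = MonoidAlgebra.single g⁻¹ a := by
  classical
  ext h
  rw [coeff_inversion]
  simp only [MonoidAlgebra.coeff_single, Finsupp.single_apply]
  exact if_congr (by constructor <;> rintro rfl <;> simp) rfl rfl

theorem eq_zero_of_mul_inversion_eq_zero {x : MonoidAlgebra ℚ G} (h : x * inversion x = 0) :
    x = 0 := by
  have h1 : (x * inversion x).coeff 1 = 0 := by simp [h]
  rw [coeff_mul_eq_sum] at h1
  simp only [coeff_inversion, mul_one, inv_inv] at h1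
  rw [Finset.sum_eq_zero_iff_of_nonneg fun i _ => mul_self_nonneg _] at h1
  ext g
  simpa using h1 g (Finset.mem_univ _)

theorem mul_inversion_mul_ne_zero {e x : MonoidAlgebra ℚ G} (hx : x ≠ 0) (hxe : x * e = x) :
    e * inversion x * x ≠ 0 := by
  intro h
  have h1 : x * inversion x * x = 0 := by
    have : x * (e * inversion x * x) = x * inversion x * x := by
      rw [← mul_assoc, ← mul_assoc, hxe]
    rw [← this, h, mul_zero]
  have h2 : x * inversion x = 0 := by
    apply eq_zero_of_mul_inversion_eq_zero
    rw [inversion_mul, inversion_inversion, ← mul_assoc, h1, zero_mul]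
  exact hx (eq_zero_of_mul_inversion_eq_zero h2)

theorem trace_single_mul_mul (g : G) (b : MonoidAlgebra ℚ G) :
    LinearMap.trace ℚ (MonoidAlgebra ℚ G)
      (LinearMap.mulLeft ℚ (MonoidAlgebra.single g 1) ∘ₗ LinearMap.mulRight ℚ b) =
      ∑ h, b.coeff (h⁻¹ * g⁻¹ * h) := by
  classical
  rw [LinearMap.trace_eq_matrix_trace ℚ (MonoidAlgebra.basis G ℚ), Matrix.trace]
  refine Finset.sum_congr rfl fun h _ => ?_
  simp [LinearMap.toMatrix_apply, MonoidAlgebra.basis, ← mul_assoc,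
    MonoidAlgebra.coeff_single_mul_apply]

instance : Module.Finite ℚ (MonoidAlgebra ℚ G) :=
  Module.Finite.of_basis (MonoidAlgebra.basis G ℚ)

/-- The trace of the action of the group algebra on a module. -/
noncomputable def traceOn (M : Type*) [AddCommGroup M] [Module ℚ M] [Module (MonoidAlgebra ℚ G) M]
    [IsScalarTower ℚ (MonoidAlgebra ℚ G) M] : MonoidAlgebra ℚ G →ₗ[ℚ] ℚ :=
  LinearMap.trace ℚ M ∘ₗ (Algebra.lsmul ℚ ℚ M).toLinearMap

section Module

variable {M N : Type*} [AddCommGroup M] [Module ℚ M] [Module (MonoidAlgebra ℚ G) M]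
  [IsScalarTower ℚ (MonoidAlgebra ℚ G) M] [AddCommGroup N] [Module ℚ N]
  [Module (MonoidAlgebra ℚ G) N] [IsScalarTower ℚ (MonoidAlgebra ℚ G) N]

theorem traceOn_apply (x : MonoidAlgebra ℚ G) :
    traceOn M x = LinearMap.trace ℚ M (Algebra.lsmul ℚ ℚ M x) := rfl

theorem traceOn_congr (f : M ≃ₗ[MonoidAlgebra ℚ G] N) (x : MonoidAlgebra ℚ G) :
    traceOn M x = traceOn N x := by
  rw [traceOn_apply, traceOn_apply, ← LinearMap.trace_conj' _ (f.restrictScalars ℚ)]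
  congr 1
  ext y
  simp [LinearEquiv.conj_apply]

theorem traceOn_idempotent [Module.Finite ℚ M] {e : MonoidAlgebra ℚ G} (he : e * e = e) :
    traceOn M e = Module.finrank ℚ (LinearMap.range (Algebra.lsmul ℚ ℚ M e)) := by
  rw [traceOn_apply]
  apply LinearMap.IsProj.trace
  refine ⟨fun x => ⟨x, rfl⟩, ?_⟩
  rintro _ ⟨y, rfl⟩
  simp [smul_smul, he]

theorem mem_span_idempotent {e : MonoidAlgebra ℚ G} (he : e * e = e) {x : MonoidAlgebra ℚ G} :
    x ∈ Submodule.span (MonoidAlgebra ℚ G) {e} ↔ x * e = x := by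
  rw [Submodule.mem_span_singleton]
  constructor
  · rintro ⟨a, rfl⟩
    simp [mul_assoc, he]
  · intro h
    exact ⟨x, h⟩

instance (I : Submodule (MonoidAlgebra ℚ G) (MonoidAlgebra ℚ G)) : Module.Finite ℚ I :=
  inferInstanceAs (Module.Finite ℚ (I.restrictScalars ℚ))

theorem traceOn_span_idempotent {e : MonoidAlgebra ℚ G} (he : e * e = e)
    (x : MonoidAlgebra ℚ G) :
    traceOn (Submodule.span (MonoidAlgebra ℚ G) {e}) x =
      LinearMap.trace ℚ (MonoidAlgebra ℚ G) (LinearMap.mulLeft ℚ x ∘ₗ LinearMap.mulRight ℚ e) := by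
  set I := (Submodule.span (MonoidAlgebra ℚ G) {e}).restrictScalars ℚ
  have hmem : ∀ y, (LinearMap.mulLeft ℚ x ∘ₗ LinearMap.mulRight ℚ e) y ∈ I := fun y => by
    change x * (y * e) ∈ Submodule.span (MonoidAlgebra ℚ G) {e}
    rw [mem_span_idempotent he]
    simp [mul_assoc, he]
  rw [← LinearMap.trace_restrict_eq_of_forall_mem I _ hmem]
  change LinearMap.trace ℚ I _ = LinearMap.trace ℚ I _
  congr 1
  refine LinearMap.ext fun ⟨y, hy⟩ => Subtype.ext ?_
  change x * y = x * (y * e)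
  rw [(mem_span_idempotent he).1 hy]

theorem traceOn_span_idempotent_single {e : MonoidAlgebra ℚ G} (he : e * e = e) (g : G) :
    traceOn (Submodule.span (MonoidAlgebra ℚ G) {e}) (MonoidAlgebra.single g 1) =
      ∑ h, e.coeff (h⁻¹ * g⁻¹ * h) := by
  rw [traceOn_span_idempotent he, trace_single_mul_mul]

end Module

end GroupAlgebra

end SymmetricRep

namespace SymmetricRep

/-! ### Counting cells -/

theorem card_filter_le_of_injective_pair {X : Type*} [Fintype X] {ν : YoungDiagram}
    (T : X ≃ {c : ℕ × ℕ // c ∈ ν.cells}) (r : X → ℕ)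
    (hr : ∀ x y, r x = r y → (T x).1.2 = (T y).1.2 → x = y) (k j : ℕ) :
    (Finset.univ.filter fun x => r x < k ∧ (T x).1.2 = j).card ≤
      (Finset.univ.filter fun x => (T x).1.1 < k ∧ (T x).1.2 = j).card := by
  classical
  have hB : (Finset.univ.filter fun x => (T x).1.1 < k ∧ (T x).1.2 = j).card =
      min k (ν.colLen j) := by
    rw [← Finset.card_range (min k (ν.colLen j))]
    refine Finset.card_bij (fun x _ => (T x).1.1) ?_ ?_ ?_
    · intro x hx
      simp only [Finset.mem_filter, Finset.mem_univ, true_and] at hx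
      have h1 : ((T x).1.1, (T x).1.2) ∈ ν := (T x).2
      rw [YoungDiagram.mem_iff_lt_colLen, hx.2] at h1
      simp [hx.1, h1]
    · intro x hx y hy hxy
      simp only [Finset.mem_filter, Finset.mem_univ, true_and] at hx hy
      exact T.injective (Subtype.ext (Prod.ext hxy (hx.2.trans hy.2.symm)))
    · intro i hi
      simp only [Finset.mem_range, lt_min_iff] at hi
      have h1 : (i, j) ∈ ν.cells := YoungDiagram.mem_iff_lt_colLen.2 hi.2
      exact ⟨T.symm ⟨(i, j), h1⟩, by simp [hi.1], by simp⟩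
  rw [hB, le_min_iff]
  constructor
  · rw [← Finset.card_range k]
    refine Finset.card_le_card_of_injOn r ?_ ?_
    · intro x hx
      simp only [Finset.coe_filter, Finset.mem_univ, true_and, Set.mem_ofPred_eq] at hx
      simpa using hx.1
    · intro x hx y hy hxy
      simp only [Finset.coe_filter, Finset.mem_univ, true_and, Set.mem_ofPred_eq] at hx hy
      exact hr x y hxy (hx.2.trans hy.2.symm)
  · rw [← Finset.card_range (ν.colLen j)]
    refine Finset.card_le_card_of_injOn (fun x => (T x).1.1) ?_ ?_
    · intro x hx
      simp only [Finset.coe_filter, Finset.mem_univ, true_and, Set.mem_ofPred_eq] at hx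
      have h1 : ((T x).1.1, (T x).1.2) ∈ ν := (T x).2
      rw [YoungDiagram.mem_iff_lt_colLen, hx.2] at h1
      simpa using h1
    · intro x hx y hy hxy
      simp only [Finset.coe_filter, Finset.mem_univ, true_and, Set.mem_ofPred_eq] at hx hy
      exact T.injective (Subtype.ext (Prod.ext hxy (hx.2.trans hy.2.symm)))

theorem card_filter_lt_eq_sum {X : Type*} [Fintype X] {ν : YoungDiagram}
    (T : X ≃ {c : ℕ × ℕ // c ∈ ν.cells}) (r : X → ℕ) (k : ℕ) :
    (Finset.univ.filter fun x => r x < k).card = ∑ j ∈ ν.cells.image Prod.snd,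
      (Finset.univ.filter fun x => r x < k ∧ (T x).1.2 = j).card := by
  classical
  rw [Finset.card_eq_sum_card_fiberwise (f := fun x => (T x).1.2) (t := ν.cells.image Prod.snd)]
  · simp only [Finset.filter_filter]
  · intro x _
    exact Finset.mem_coe.2 (Finset.mem_image_of_mem _ (T x).2)

theorem card_lt_le_of_injective_pair {X : Type*} [Fintype X] {ν : YoungDiagram}
    (T : X ≃ {c : ℕ × ℕ // c ∈ ν.cells}) (r : X → ℕ)
    (hr : ∀ x y, r x = r y → (T x).1.2 = (T y).1.2 → x = y) (k : ℕ) :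
    (Finset.univ.filter fun x => r x < k).card ≤
      (Finset.univ.filter fun x => (T x).1.1 < k).card := by
  rw [card_filter_lt_eq_sum T, card_filter_lt_eq_sum T]
  exact Finset.sum_le_sum fun j _ => card_filter_le_of_injective_pair T r hr k j

theorem mem_of_injective_pair {X : Type*} [Fintype X] {ν : YoungDiagram}
    (T : X ≃ {c : ℕ × ℕ // c ∈ ν.cells}) (r : X → ℕ)
    (hr : ∀ x y, r x = r y → (T x).1.2 = (T y).1.2 → x = y)
    (heq : ∀ k, (Finset.univ.filter fun x => r x < k).card =
      (Finset.univ.filter fun x => (T x).1.1 < k).card) (x : X) :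
    (r x, (T x).1.2) ∈ ν.cells := by
  classical
  set j := (T x).1.2 with hj
  set k := ν.colLen j
  have h1 := heq k
  rw [card_filter_lt_eq_sum T, card_filter_lt_eq_sum T,
    Finset.sum_eq_sum_iff_of_le
      (fun j _ => card_filter_le_of_injective_pair T r hr k j)] at h1
  have h2 := h1 j (Finset.mem_image_of_mem _ (T x).2)
  have h3 : (Finset.univ.filter fun x => (T x).1.1 < k ∧ (T x).1.2 = j) =
      Finset.univ.filter fun x => (T x).1.2 = j := by
    ext y
    simp only [Finset.mem_filter, Finset.mem_univ, true_and, and_iff_right_iff_imp]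
    intro hy
    have h4 : ((T y).1.1, (T y).1.2) ∈ ν := (T y).2
    rwa [YoungDiagram.mem_iff_lt_colLen, hy] at h4
  rw [h3] at h2
  have h5 := Finset.eq_of_subset_of_card_le (s := Finset.univ.filter fun x => r x < k ∧ (T x).1.2 = j)
    (t := Finset.univ.filter fun x => (T x).1.2 = j)
    (fun y hy => by simp only [Finset.mem_filter, Finset.mem_univ, true_and] at hy ⊢; exact hy.2)
    h2.ge
  have h6 : x ∈ Finset.univ.filter fun x => (T x).1.2 = j := by simp [hj]
  rw [← h5] at h6
  simp only [Finset.mem_filter, Finset.mem_univ, true_and] at h6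
  exact YoungDiagram.mem_iff_lt_colLen.2 h6.1

theorem card_filter_row_eq {X : Type*} [Fintype X] {ν : YoungDiagram}
    (T : X ≃ {c : ℕ × ℕ // c ∈ ν.cells}) (i : ℕ) :
    (Finset.univ.filter fun x => (T x).1.1 = i).card = ν.rowLen i := by
  classical
  rw [YoungDiagram.rowLen_eq_card]
  refine Finset.card_bij (fun x _ => (T x).1) ?_ ?_ ?_
  · intro x hx
    simp only [Finset.mem_filter, Finset.mem_univ, true_and] at hx
    exact YoungDiagram.mem_row_iff.2 ⟨(T x).2, hx⟩
  · intro x _ y _ hxy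
    exact T.injective (Subtype.ext hxy)
  · intro c hc
    rw [YoungDiagram.mem_row_iff] at hc
    exact ⟨T.symm ⟨c, hc.1⟩, by simp [hc.2], by simp⟩

theorem card_filter_lt_row_succ {X : Type*} [Fintype X] {ν : YoungDiagram}
    (T : X ≃ {c : ℕ × ℕ // c ∈ ν.cells}) (k : ℕ) :
    (Finset.univ.filter fun x => (T x).1.1 < k + 1).card =
      (Finset.univ.filter fun x => (T x).1.1 < k).card + ν.rowLen k := by
  classical
  rw [← card_filter_row_eq T k, ← Finset.card_union_of_disjoint]
  · congr 1
    ext x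
    simp only [Finset.mem_filter, Finset.mem_univ, true_and, Finset.mem_union]
    omega
  · rw [Finset.disjoint_left]
    intro x h1 h2
    simp only [Finset.mem_filter, Finset.mem_univ, true_and] at h1 h2
    omega

theorem eq_of_rowLen_eq {μ ν : YoungDiagram} (h : ∀ i, μ.rowLen i = ν.rowLen i) : μ = ν := by
  ext ⟨i, j⟩
  rw [YoungDiagram.mem_cells, YoungDiagram.mem_cells, YoungDiagram.mem_iff_lt_rowLen,
    YoungDiagram.mem_iff_lt_rowLen, h]

/-! ### Row and column stabilizers -/

section Young

variable {m : ℕ} (μ : YoungDiagram) (h : μ.card = m)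

theorem mem_rowStabilizer {g : Equiv.Perm (Fin m)} :
    g ∈ rowStabilizer μ h ↔ ∀ k, (tableau μ h (g k)).1.1 = (tableau μ h k).1.1 := by
  simp [rowStabilizer]

theorem mem_colStabilizer {g : Equiv.Perm (Fin m)} :
    g ∈ colStabilizer μ h ↔ ∀ k, (tableau μ h (g k)).1.2 = (tableau μ h k).1.2 := by
  simp [colStabilizer]

theorem one_mem_rowStabilizer : 1 ∈ rowStabilizer μ h := by simp [mem_rowStabilizer]

theorem one_mem_colStabilizer : 1 ∈ colStabilizer μ h := by simp [mem_colStabilizer]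

variable {μ h}

theorem mul_mem_rowStabilizer {p q : Equiv.Perm (Fin m)} (hp : p ∈ rowStabilizer μ h) :
    p * q ∈ rowStabilizer μ h ↔ q ∈ rowStabilizer μ h := by
  simp only [mem_rowStabilizer] at *
  simp [hp]

theorem inv_mem_rowStabilizer {p : Equiv.Perm (Fin m)} :
    p⁻¹ ∈ rowStabilizer μ h ↔ p ∈ rowStabilizer μ h := by
  simp only [mem_rowStabilizer]
  exact ⟨fun H k => by simpa using (H (p k)).symm, fun H k => by simpa using (H (p⁻¹ k)).symm⟩

theorem mul_mem_colStabilizer {p q : Equiv.Perm (Fin m)} (hp : p ∈ colStabilizer μ h) :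
    p * q ∈ colStabilizer μ h ↔ q ∈ colStabilizer μ h := by
  simp only [mem_colStabilizer] at *
  simp [hp]

theorem inv_mem_colStabilizer {p : Equiv.Perm (Fin m)} :
    p⁻¹ ∈ colStabilizer μ h ↔ p ∈ colStabilizer μ h := by
  simp only [mem_colStabilizer]
  exact ⟨fun H k => by simpa using (H (p k)).symm, fun H k => by simpa using (H (p⁻¹ k)).symm⟩

theorem eq_one_of_mem_stabilizers {g : Equiv.Perm (Fin m)} (hr : g ∈ rowStabilizer μ h)
    (hc : g ∈ colStabilizer μ h) : g = 1 := by
  ext1 k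
  rw [mem_rowStabilizer] at hr
  rw [mem_colStabilizer] at hc
  exact (tableau μ h).injective (Subtype.ext (Prod.ext (hr k) (hc k)))

/-- The sign of a permutation as a rational number. -/
def ratSign (g : Equiv.Perm (Fin m)) : ℚ := ((Equiv.Perm.sign g : ℤ) : ℚ)

theorem ratSign_mul (g k : Equiv.Perm (Fin m)) : ratSign (g * k) = ratSign g * ratSign k := by
  simp [ratSign]

theorem ratSign_inv (g : Equiv.Perm (Fin m)) : ratSign g⁻¹ = ratSign g := by
  simp [ratSign]

theorem ratSign_mul_self (g : Equiv.Perm (Fin m)) : ratSign g * ratSign g = 1 := by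
  rw [← ratSign_inv g, ratSign_inv, ← ratSign_inv g, ratSign_inv]
  nth_rewrite 1 [← ratSign_inv g]
  rw [← ratSign_mul]
  simp [ratSign]

variable (μ h)

/-- The sum of the row stabilizer. -/
noncomputable def rowSum : GroupAlg m := ∑ p ∈ rowStabilizer μ h, MonoidAlgebra.single p (1 : ℚ)

/-- The signed sum of the column stabilizer. -/
noncomputable def colSum : GroupAlg m :=
  ∑ q ∈ colStabilizer μ h, MonoidAlgebra.single q (ratSign q)

theorem youngSymmetrizer_eq : youngSymmetrizer μ h = rowSum μ h * colSum μ h := rfl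

theorem coeff_rowSum (g : Equiv.Perm (Fin m)) :
    (rowSum μ h).coeff g = if g ∈ rowStabilizer μ h then 1 else 0 := by
  simp [rowSum, MonoidAlgebra.coeff_sum, Finsupp.single_apply]

theorem coeff_colSum (g : Equiv.Perm (Fin m)) :
    (colSum μ h).coeff g = if g ∈ colStabilizer μ h then ratSign g else 0 := by
  simp [colSum, MonoidAlgebra.coeff_sum, Finsupp.single_apply]

theorem inversion_rowSum : inversion (rowSum μ h) = rowSum μ h := by
  ext g
  rw [coeff_inversion, coeff_rowSum, coeff_rowSum]
  simp only [inv_mem_rowStabilizer]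

theorem inversion_colSum : inversion (colSum μ h) = colSum μ h := by
  ext g
  rw [coeff_inversion, coeff_colSum, coeff_colSum]
  simp only [inv_mem_colStabilizer, ratSign_inv]

variable {μ h}

theorem single_mul_rowSum {p : Equiv.Perm (Fin m)} (hp : p ∈ rowStabilizer μ h) :
    MonoidAlgebra.single p 1 * rowSum μ h = rowSum μ h := by
  ext g
  rw [MonoidAlgebra.coeff_single_mul_apply, coeff_rowSum, coeff_rowSum, one_mul]
  simp only [mul_mem_rowStabilizer (inv_mem_rowStabilizer.2 hp)]

theorem rowSum_mul_single {p : Equiv.Perm (Fin m)} (hp : p ∈ rowStabilizer μ h) :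
    rowSum μ h * MonoidAlgebra.single p 1 = rowSum μ h := by
  have := congrArg inversion (single_mul_rowSum (inv_mem_rowStabilizer.2 hp))
  rwa [inversion_mul, inversion_single, inversion_rowSum, inv_inv] at this

theorem single_mul_colSum {q : Equiv.Perm (Fin m)} (hq : q ∈ colStabilizer μ h) :
    MonoidAlgebra.single q 1 * colSum μ h = ratSign q • colSum μ h := by
  ext g
  rw [MonoidAlgebra.coeff_single_mul_apply, MonoidAlgebra.coeff_smul_apply, coeff_colSum,
    coeff_colSum, one_mul]
  simp only [mul_mem_colStabilizer (inv_mem_colStabilizer.2 hq), ratSign_mul, ratSign_inv]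
  split_ifs <;> simp

theorem colSum_mul_single {q : Equiv.Perm (Fin m)} (hq : q ∈ colStabilizer μ h) :
    colSum μ h * MonoidAlgebra.single q 1 = ratSign q • colSum μ h := by
  have := congrArg inversion (single_mul_colSum (inv_mem_colStabilizer.2 hq))
  rwa [inversion_mul, inversion_single, map_smul, inversion_colSum, inv_inv, ratSign_inv] at this

theorem swap_mem_rowStabilizer {x y : Fin m}
    (hxy : (tableau μ h x).1.1 = (tableau μ h y).1.1) : Equiv.swap x y ∈ rowStabilizer μ h := by
  rw [mem_rowStabilizer]
  intro k
  by_cases h1 : k = x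
  · subst h1; simp [hxy]
  by_cases h2 : k = y
  · subst h2; simp [hxy]
  rw [Equiv.swap_apply_of_ne_of_ne h1 h2]

theorem swap_mem_colStabilizer {x y : Fin m}
    (hxy : (tableau μ h x).1.2 = (tableau μ h y).1.2) : Equiv.swap x y ∈ colStabilizer μ h := by
  rw [mem_colStabilizer]
  intro k
  by_cases h1 : k = x
  · subst h1; simp [hxy]
  by_cases h2 : k = y
  · subst h2; simp [hxy]
  rw [Equiv.swap_apply_of_ne_of_ne h1 h2]

theorem ratSign_swap {x y : Fin m} (hxy : x ≠ y) : ratSign (Equiv.swap x y) = -1 := by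
  simp [ratSign, Equiv.Perm.sign_swap hxy]

theorem swap_mul_eq_mul_swap (g : Equiv.Perm (Fin m)) (x y : Fin m) :
    Equiv.swap x y * g = g * Equiv.swap (g⁻¹ x) (g⁻¹ y) := by
  rw [Equiv.mul_swap_eq_swap_mul]
  simp

variable {ν : YoungDiagram} {h' : ν.card = m}

theorem rowSum_mul_single_mul_colSum_eq_zero (g : Equiv.Perm (Fin m)) {x y : Fin m} (hxy : x ≠ y)
    (hr : (tableau μ h x).1.1 = (tableau μ h y).1.1)
    (hc : (tableau ν h' (g⁻¹ x)).1.2 = (tableau ν h' (g⁻¹ y)).1.2) :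
    rowSum μ h * MonoidAlgebra.single g 1 * colSum ν h' = 0 := by
  have key : rowSum μ h * MonoidAlgebra.single g 1 * colSum ν h' =
      -(rowSum μ h * MonoidAlgebra.single g 1 * colSum ν h') := by
    conv_lhs => rw [← rowSum_mul_single (swap_mem_rowStabilizer hr)]
    rw [mul_assoc (rowSum μ h), MonoidAlgebra.single_mul_single, swap_mul_eq_mul_swap, mul_one]
    have : (MonoidAlgebra.single (g * Equiv.swap (g⁻¹ x) (g⁻¹ y)) (1 : ℚ)) =
        MonoidAlgebra.single g 1 * MonoidAlgebra.single (Equiv.swap (g⁻¹ x) (g⁻¹ y)) 1 := by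
      rw [MonoidAlgebra.single_mul_single, mul_one]
    rw [this, mul_assoc, mul_assoc, single_mul_colSum (swap_mem_colStabilizer hc),
      ratSign_swap (fun hh => hxy (g⁻¹.injective hh))]
    simp [mul_assoc]
  ext k
  have hk := congrArg (fun y => y.coeff k) key
  simp only [MonoidAlgebra.coeff_neg, Finsupp.coe_neg, Pi.neg_apply] at hk
  simp only [MonoidAlgebra.coeff_zero, Finsupp.coe_zero, Pi.zero_apply]
  linarith

theorem card_lt_le_of_rowSum_mul_mul_colSum_ne_zero {x : GroupAlg m}
    (hx : rowSum μ h * x * colSum ν h' ≠ 0) (k : ℕ) :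
    (Finset.univ.filter fun i => (tableau μ h i).1.1 < k).card ≤
      (Finset.univ.filter fun i => (tableau ν h' i).1.1 < k).card := by
  have : ∃ g, rowSum μ h * MonoidAlgebra.single g 1 * colSum ν h' ≠ 0 := by
    by_contra! H
    apply hx
    rw [eq_sum_single x, Finset.mul_sum, Finset.sum_mul]
    exact Finset.sum_eq_zero fun g _ => by
      rw [mul_smul_comm, smul_mul_assoc, H, smul_zero]
  obtain ⟨g, hg⟩ := this
  refine (card_lt_le_of_injective_pair ((g⁻¹ : Equiv.Perm (Fin m)).trans (tableau ν h'))
    (fun i => (tableau μ h i).1.1) ?_ k).trans ?_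
  · intro x y hr hc
    by_contra hxy
    exact hg (rowSum_mul_single_mul_colSum_eq_zero g hxy hr hc)
  · refine Finset.card_le_card_of_injOn (fun i => g⁻¹ i) ?_ (g⁻¹.injective.injOn)
    intro i hi
    rw [Finset.mem_coe, Finset.mem_filter] at hi ⊢
    exact ⟨Finset.mem_univ _, hi.2⟩

theorem youngSymmetrizer_mul_mul_eq_zero (hne : μ ≠ ν) (x : GroupAlg m) :
    youngSymmetrizer μ h * x * youngSymmetrizer ν h' = 0 := by
  by_contra H
  rw [youngSymmetrizer_eq, youngSymmetrizer_eq] at H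
  have h1 : rowSum μ h * (colSum μ h * x * rowSum ν h') * colSum ν h' ≠ 0 := by
    simpa only [mul_assoc] using H
  have h2 : rowSum ν h' * inversion x * colSum μ h ≠ 0 := by
    intro h3
    have h4 := congrArg inversion h3
    rw [inversion_mul, inversion_mul, inversion_inversion, inversion_colSum, inversion_rowSum,
      map_zero, ← mul_assoc] at h4
    rw [h4] at h1
    simp at h1
  have h5 := fun k => le_antisymm (card_lt_le_of_rowSum_mul_mul_colSum_ne_zero h1 k)
    (card_lt_le_of_rowSum_mul_mul_colSum_ne_zero h2 k)
  refine hne (eq_of_rowLen_eq fun i => ?_)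
  have h6 := card_filter_lt_row_succ (tableau μ h) i
  have h7 := card_filter_lt_row_succ (tableau ν h') i
  have h8 := h5 (i + 1)
  have h9 := h5 i
  omega

theorem exists_mul_of_injective_pair (g : Equiv.Perm (Fin m))
    (hg : ∀ x y, (tableau μ h x).1.1 = (tableau μ h y).1.1 →
      (tableau μ h (g⁻¹ x)).1.2 = (tableau μ h (g⁻¹ y)).1.2 → x = y) :
    ∃ p ∈ rowStabilizer μ h, ∃ q ∈ colStabilizer μ h, g = p * q := by
  have hmem := mem_of_injective_pair ((g⁻¹ : Equiv.Perm (Fin m)).trans (tableau μ h))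
    (fun i => (tableau μ h i).1.1) hg (fun k => by
      refine Finset.card_bij (fun i _ => g i) ?_ (fun _ _ _ _ hh => g.injective hh) ?_
      · intro i hi
        rw [Finset.mem_filter] at hi ⊢
        simpa using hi
      · intro i hi
        refine ⟨g⁻¹ i, ?_, by simp⟩
        rw [Finset.mem_filter] at hi ⊢
        exact ⟨Finset.mem_univ _, hi.2⟩)
  let f : Fin m → Fin m := fun x =>
    (tableau μ h).symm ⟨((tableau μ h x).1.1, (tableau μ h (g⁻¹ x)).1.2), hmem x⟩
  have hf : ∀ x, (tableau μ h (f x)).1 = ((tableau μ h x).1.1, (tableau μ h (g⁻¹ x)).1.2) :=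
    fun x => by simp [f]
  have hinj : Function.Injective f := fun x y hxy => by
    have h1 := hf x
    rw [hxy, hf y, Prod.mk.injEq] at h1
    exact hg x y h1.1.symm h1.2.symm
  let p : Equiv.Perm (Fin m) := Equiv.ofBijective f (Finite.injective_iff_bijective.1 hinj)
  have hp : p ∈ rowStabilizer μ h := (mem_rowStabilizer μ h).2 fun k => by
    change (tableau μ h (f k)).1.1 = _
    rw [hf]
  have hq : p * g ∈ colStabilizer μ h := (mem_colStabilizer μ h).2 fun k => by
    change (tableau μ h (f (g k))).1.2 = _
    rw [hf]
    simp
  exact ⟨p⁻¹, inv_mem_rowStabilizer.2 hp, p * g, hq, by simp⟩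

theorem coeff_youngSymmetrizer_one : (youngSymmetrizer μ h).coeff 1 = 1 := by
  rw [youngSymmetrizer_eq, coeff_mul_eq_sum, Finset.sum_eq_single 1]
  · simp [coeff_rowSum, coeff_colSum, one_mem_rowStabilizer, one_mem_colStabilizer, ratSign]
  · intro g _ hg
    rw [coeff_rowSum, coeff_colSum, mul_one]
    by_cases h1 : g ∈ rowStabilizer μ h
    · have h2 : g⁻¹ ∉ colStabilizer μ h := fun h3 =>
        hg (eq_one_of_mem_stabilizers h1 (inv_mem_colStabilizer.1 h3))
      simp [h2]
    · simp [h1]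
  · simp

theorem eq_smul_youngSymmetrizer_aux {x : GroupAlg m}
    (hx : ∀ p ∈ rowStabilizer μ h, ∀ q ∈ colStabilizer μ h, ∀ g,
      x.coeff (p * g * q) = ratSign q * x.coeff g) (h1 : x.coeff 1 = 0) : x = 0 := by
  ext g
  by_cases hg : ∀ x y, (tableau μ h x).1.1 = (tableau μ h y).1.1 →
      (tableau μ h (g⁻¹ x)).1.2 = (tableau μ h (g⁻¹ y)).1.2 → x = y
  · obtain ⟨p, hp, q, hq, rfl⟩ := exists_mul_of_injective_pair g hg
    have := hx p hp q hq 1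
    rw [mul_one, h1, mul_zero] at this
    simpa using this
  · push Not at hg
    obtain ⟨i, j, hr, hc, hij⟩ := hg
    have h2 := hx _ (swap_mem_rowStabilizer hr) _ (swap_mem_colStabilizer hc) g
    rw [swap_mul_eq_mul_swap, mul_assoc, Equiv.swap_mul_self, mul_one,
      ratSign_swap (fun hh => hij (g⁻¹.injective hh))] at h2
    simp only [MonoidAlgebra.coeff_zero, Finsupp.coe_zero, Pi.zero_apply]
    linarith

theorem youngSymmetrizer_mul_mul_coeff (x : GroupAlg m) :
    ∀ p ∈ rowStabilizer μ h, ∀ q ∈ colStabilizer μ h, ∀ g,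
      (rowSum μ h * x * colSum μ h).coeff (p * g * q) =
        ratSign q * (rowSum μ h * x * colSum μ h).coeff g := by
  intro p hp q hq g
  have h1 : MonoidAlgebra.single p⁻¹ 1 * (rowSum μ h * x * colSum μ h) *
      MonoidAlgebra.single q⁻¹ 1 = ratSign q • (rowSum μ h * x * colSum μ h) := by
    rw [mul_assoc, mul_assoc, colSum_mul_single (inv_mem_colStabilizer.2 hq), ratSign_inv,
      mul_smul_comm, mul_smul_comm, mul_assoc, ← mul_assoc (MonoidAlgebra.single p⁻¹ 1),
      single_mul_rowSum (inv_mem_rowStabilizer.2 hp)]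
  generalize rowSum μ h * x * colSum μ h = y at h1 ⊢
  have h2 := congrArg (fun y => y.coeff g) h1
  simpa [MonoidAlgebra.coeff_single_mul_apply, MonoidAlgebra.coeff_mul_single_apply,
    mul_assoc] using h2

theorem rowSum_mul_mul_colSum (x : GroupAlg m) :
    rowSum μ h * x * colSum μ h =
      (rowSum μ h * x * colSum μ h).coeff 1 • youngSymmetrizer μ h := by
  rw [← sub_eq_zero]
  refine eq_smul_youngSymmetrizer_aux (μ := μ) (h := h) ?_ ?_
  · intro p hp q hq g
    have h1 := youngSymmetrizer_mul_mul_coeff (μ := μ) (h := h) x p hp q hq g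
    have h2 := youngSymmetrizer_mul_mul_coeff (μ := μ) (h := h) 1 p hp q hq g
    rw [mul_one, ← youngSymmetrizer_eq] at h2
    simp only [MonoidAlgebra.coeff_sub, MonoidAlgebra.coeff_smul, Finsupp.coe_sub,
      Finsupp.coe_smul, Pi.sub_apply, Pi.smul_apply, smul_eq_mul, h1, h2]
    ring
  · simp [coeff_youngSymmetrizer_one]

variable (μ h)

/-- The scalar `n` with `c_μ² = n c_μ`. -/
noncomputable def youngScalar : ℚ := (youngSymmetrizer μ h * youngSymmetrizer μ h).coeff 1

theorem youngSymmetrizer_mul_self :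
    youngSymmetrizer μ h * youngSymmetrizer μ h = youngScalar μ h • youngSymmetrizer μ h := by
  have := rowSum_mul_mul_colSum (μ := μ) (h := h) (colSum μ h * rowSum μ h)
  rw [← mul_assoc, mul_assoc, ← youngSymmetrizer_eq] at this
  exact this

theorem youngScalar_ne_zero : youngScalar μ h ≠ 0 := by
  intro h0
  have h1 := youngSymmetrizer_mul_self μ h
  rw [h0, zero_smul] at h1
  have h2 : IsNilpotent (LinearMap.mulLeft ℚ (MonoidAlgebra.single 1 1) ∘ₗ
      LinearMap.mulRight ℚ (youngSymmetrizer μ h)) := by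
    refine ⟨2, LinearMap.ext fun x => ?_⟩
    simp [pow_two, mul_assoc, h1, ← MonoidAlgebra.one_def]
  have h3 := (LinearMap.isNilpotent_trace_of_isNilpotent h2).eq_zero
  rw [trace_single_mul_mul] at h3
  simp [coeff_youngSymmetrizer_one, Fintype.card_perm, Nat.factorial_ne_zero] at h3

/-- The primitive idempotent proportional to the Young symmetrizer. -/
noncomputable def youngIdempotent : GroupAlg m := (youngScalar μ h)⁻¹ • youngSymmetrizer μ h

theorem youngSymmetrizer_eq_smul :
    youngSymmetrizer μ h = youngScalar μ h • youngIdempotent μ h := by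
  rw [youngIdempotent, smul_smul, mul_inv_cancel₀ (youngScalar_ne_zero μ h), one_smul]

theorem youngIdempotent_mul_self :
    youngIdempotent μ h * youngIdempotent μ h = youngIdempotent μ h := by
  simp only [youngIdempotent, smul_mul_assoc, mul_smul_comm, youngSymmetrizer_mul_self, smul_smul]
  rw [inv_mul_cancel₀ (youngScalar_ne_zero μ h), mul_one]

theorem simpleModule_eq :
    simpleModule μ h = Submodule.span (GroupAlg m) {youngIdempotent μ h} := by
  apply le_antisymm <;> rw [simpleModule, Submodule.span_singleton_le_iff_mem,
    Submodule.mem_span_singleton]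
  · exact ⟨algebraMap ℚ _ (youngScalar μ h), by
      rw [algebraMap_smul, ← youngSymmetrizer_eq_smul]⟩
  · exact ⟨algebraMap ℚ _ (youngScalar μ h)⁻¹, by rw [algebraMap_smul]; rfl⟩

variable {μ h}

theorem youngIdempotent_mul_mul_eq_zero (hne : μ ≠ ν) (x : GroupAlg m) :
    youngIdempotent μ h * x * youngIdempotent ν h' = 0 := by
  simp [youngIdempotent, youngSymmetrizer_mul_mul_eq_zero hne]

theorem exists_youngIdempotent_mul_mul (x : GroupAlg m) :
    ∃ a : ℚ, youngIdempotent μ h * x * youngIdempotent μ h = a • youngIdempotent μ h := by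
  have := rowSum_mul_mul_colSum (μ := μ) (h := h) (colSum μ h * x * rowSum μ h)
  rw [← mul_assoc, ← mul_assoc, mul_assoc _ (rowSum μ h), ← youngSymmetrizer_eq] at this
  obtain ⟨b, hb⟩ : ∃ b : ℚ, youngSymmetrizer μ h * x * youngSymmetrizer μ h =
    b • youngSymmetrizer μ h := ⟨_, this⟩
  refine ⟨(youngScalar μ h)⁻¹ * b, ?_⟩
  simp only [youngIdempotent, smul_mul_assoc, mul_smul_comm, hb, smul_smul]
  congr 1
  ring

theorem traceOn_simpleModule_self : traceOn (simpleModule μ h) (youngIdempotent μ h) = 1 := by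
  rw [simpleModule_eq, traceOn_span_idempotent (youngIdempotent_mul_self μ h)]
  have hc : (youngIdempotent μ h).coeff 1 ≠ 0 := by
    simp [youngIdempotent, coeff_youngSymmetrizer_one, youngScalar_ne_zero]
  choose a ha using fun x => exists_youngIdempotent_mul_mul (μ := μ) (h := h) x
  have ha' : ∀ x, (youngIdempotent μ h * x * youngIdempotent μ h).coeff 1 *
      ((youngIdempotent μ h).coeff 1)⁻¹ = a x := fun x => by
    rw [ha x, MonoidAlgebra.coeff_smul_apply, smul_eq_mul, mul_assoc, mul_inv_cancel₀ hc, mul_one]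
  let f : GroupAlg m →ₗ[ℚ] ℚ :=
    { toFun := a
      map_add' := fun x y => by
        rw [← ha', ← ha', ← ha', mul_add, add_mul, MonoidAlgebra.coeff_add, Finsupp.add_apply,
          add_mul]
      map_smul' := fun b x => by
        rw [← ha', ← ha', mul_smul_comm, smul_mul_assoc, MonoidAlgebra.coeff_smul_apply,
          smul_eq_mul, mul_assoc, RingHom.id_apply, smul_eq_mul] }
  have hf : LinearMap.mulLeft ℚ (youngIdempotent μ h) ∘ₗ
      LinearMap.mulRight ℚ (youngIdempotent μ h) = f.smulRight (youngIdempotent μ h) :=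
    LinearMap.ext fun x => by
      simp only [LinearMap.comp_apply, LinearMap.mulLeft_apply, LinearMap.mulRight_apply,
        LinearMap.smulRight_apply, ← mul_assoc]
      exact ha x
  rw [hf, LinearMap.trace_smulRight]
  change a (youngIdempotent μ h) = 1
  rw [← ha', youngIdempotent_mul_self, youngIdempotent_mul_self, mul_inv_cancel₀ hc]

theorem smul_simpleModule_eq_zero (hne : μ ≠ ν) (x : simpleModule ν h') :
    youngIdempotent μ h • x = 0 := by
  obtain ⟨x, hx⟩ := x
  rw [simpleModule_eq, mem_span_idempotent (youngIdempotent_mul_self ν h')] at hx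
  refine Subtype.ext ?_
  change youngIdempotent μ h * x = 0
  rw [← hx, ← mul_assoc, youngIdempotent_mul_mul_eq_zero hne]

theorem traceOn_simpleModule_of_ne (hne : μ ≠ ν) :
    traceOn (simpleModule ν h') (youngIdempotent μ h) = 0 := by
  rw [traceOn_apply]
  have : Algebra.lsmul ℚ ℚ (simpleModule ν h') (youngIdempotent μ h) = 0 :=
    LinearMap.ext fun x => smul_simpleModule_eq_zero hne x
  rw [this, map_zero]

end Young

end SymmetricRep

namespace SymmetricRep

/-! ### Cycle types as exponents -/

section CycleExponent

variable {m : ℕ}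

theorem finite_support_numCycles (g : Equiv.Perm (Fin m)) :
    (Function.support fun i : ℕ+ => numCycles g i).Finite := by
  refine Set.Finite.of_finite_image (f := fun i : ℕ+ => (i : ℕ)) ?_ PNat.coe_injective.injOn
  refine (g.partition.parts.toFinset.finite_toSet).subset ?_
  rintro _ ⟨i, hi, rfl⟩
  simp only [Function.mem_support, numCycles] at hi
  simpa using Multiset.count_ne_zero.1 hi

/-- The cycle type of a permutation as an exponent vector. -/
noncomputable def cycleExponent (g : Equiv.Perm (Fin m)) : ℕ+ →₀ ℕ :=
  Finsupp.ofSupportFinite (fun i => numCycles g i) (finite_support_numCycles g)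

theorem cycleExponent_apply (g : Equiv.Perm (Fin m)) (i : ℕ+) :
    cycleExponent g i = numCycles g i := rfl

/-- The number `∑ i σ_i` of points permuted by a permutation with cycle type `σ`. -/
noncomputable abbrev cycleWeight : (ℕ+ →₀ ℕ) →+ ℕ := Finsupp.weight fun i : ℕ+ => (i : ℕ)

theorem numCycles_eq (g : Equiv.Perm (Fin m)) (i : ℕ+) :
    numCycles g i = g.cycleType.count (i : ℕ) + if (i : ℕ) = 1 then m - g.cycleType.sum else 0 := by
  rw [numCycles, Equiv.Perm.parts_partition, Multiset.count_add, Multiset.count_replicate,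
    ← Equiv.Perm.sum_cycleType, Fintype.card_fin]
  simp only [eq_comm]

/-- The sum over the support of the cycle exponent is a sum over the cycle lengths. -/
theorem prod_cycleExponent {M : Type*} [CommMonoid M] (g : Equiv.Perm (Fin m)) (f : ℕ → ℕ → M) :
    ((cycleExponent g).prod fun i n => f i n) =
      ∏ i ∈ g.partition.parts.toFinset, f i (g.partition.parts.count i) := by
  rw [Finsupp.prod]
  refine Finset.prod_bij (fun i _ => (i : ℕ)) ?_ ?_ ?_ ?_
  · intro i hi
    rw [Finsupp.mem_support_iff, cycleExponent_apply, numCycles] at hi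
    simpa using Multiset.count_ne_zero.1 hi
  · intro i _ j _ hij
    exact PNat.coe_injective hij
  · intro n hn
    rw [Multiset.mem_toFinset] at hn
    obtain ⟨i, rfl⟩ : ∃ i : ℕ+, (i : ℕ) = n := ⟨⟨n, g.partition.parts_pos hn⟩, rfl⟩
    refine ⟨i, ?_, rfl⟩
    rw [Finsupp.mem_support_iff, cycleExponent_apply, numCycles]
    exact Multiset.count_ne_zero.2 hn
  · intro i _
    rfl

theorem cycleWeight_cycleExponent (g : Equiv.Perm (Fin m)) :
    cycleWeight (cycleExponent g) = m := by
  have h1 := prod_cycleExponent (M := Multiplicative ℕ) g fun i n => Multiplicative.ofAdd (n * i)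
  have h2 : cycleWeight (cycleExponent g) =
      ∑ i ∈ g.partition.parts.toFinset, g.partition.parts.count i * i := by
    rw [cycleWeight, Finsupp.weight_apply]
    exact h1
  rw [h2]
  have h3 := g.partition.parts_sum
  rw [Finset.sum_multiset_count] at h3
  simp only [smul_eq_mul] at h3
  exact h3.trans (Fintype.card_fin m)

theorem cycleExponent_eq_iff {g k : Equiv.Perm (Fin m)} :
    cycleExponent g = cycleExponent k ↔ IsConj g k := by
  constructor
  · intro h
    rw [Equiv.Perm.partition_eq_of_isConj]
    apply Nat.Partition.ext
    ext i
    rcases Nat.eq_zero_or_pos i with rfl | hi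
    · rw [Multiset.count_eq_zero_of_notMem, Multiset.count_eq_zero_of_notMem]
      · exact fun h => (Nat.lt_irrefl _ (k.partition.parts_pos h))
      · exact fun h => (Nat.lt_irrefl _ (g.partition.parts_pos h))
    · exact DFunLike.congr_fun h ⟨i, hi⟩
  · intro h
    ext i
    rw [cycleExponent_apply, cycleExponent_apply, numCycles, numCycles,
      Equiv.Perm.partition_eq_of_isConj.1 h]

theorem cycleExponent_inv (g : Equiv.Perm (Fin m)) : cycleExponent g⁻¹ = cycleExponent g := by
  rw [cycleExponent_eq_iff, Equiv.Perm.isConj_iff_cycleType_eq, Equiv.Perm.cycleType_inv]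

theorem sum_map_toMultiset (σ : ℕ+ →₀ ℕ) :
    ((Finsupp.toMultiset σ).map fun i : ℕ+ => (i : ℕ)).sum = cycleWeight σ := by
  induction σ using Finsupp.induction_linear with
  | zero => simp
  | add f g hf hg => rw [map_add, map_add, Multiset.map_add, Multiset.sum_add, hf, hg]
  | single i n => simp [Finsupp.toMultiset_single, Multiset.map_nsmul, Multiset.sum_nsmul,
      Finsupp.weight_single]

theorem exists_cycleExponent_eq {σ : ℕ+ →₀ ℕ} (hσ : cycleWeight σ = m) :
    ∃ g : Equiv.Perm (Fin m), cycleExponent g = σ := by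
  classical
  set M : Multiset ℕ := (Finsupp.toMultiset σ).map fun i : ℕ+ => (i : ℕ) with hM
  have hcount : ∀ i : ℕ+, M.count (i : ℕ) = σ i := fun i => by
    rw [hM, Multiset.count_map_eq_count' _ _ PNat.coe_injective, Finsupp.count_toMultiset]
  have hsum : M.sum = m := by
    rw [← hσ, hM, sum_map_toMultiset]
  have hpos : ∀ n ∈ M, 0 < n := by
    intro n hn
    rw [hM, Multiset.mem_map] at hn
    obtain ⟨i, -, rfl⟩ := hn
    exact i.pos
  have hsplit : M = M.filter (2 ≤ ·) + Multiset.replicate (M.count 1) 1 := by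
    conv_lhs => rw [← Multiset.filter_add_not (2 ≤ ·) M]
    congr 1
    rw [← Multiset.filter_eq']
    refine Multiset.filter_congr fun n hn => ?_
    have := hpos n hn
    omega
  have hsum' : (M.filter (2 ≤ ·)).sum + M.count 1 = m := by
    conv_rhs => rw [← hsum, hsplit]
    simp
  obtain ⟨g, hg⟩ := (Equiv.Perm.exists_with_cycleType_iff (Fin m)
    (m := M.filter (2 ≤ ·))).2 ⟨by rw [Fintype.card_fin]; omega, fun n hn =>
      (Multiset.mem_filter.1 hn).2⟩
  refine ⟨g, ?_⟩
  ext i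
  rw [cycleExponent_apply, numCycles_eq, hg, ← hcount i]
  conv_rhs => rw [hsplit]
  rw [Multiset.count_add, Multiset.count_replicate]
  simp only [eq_comm (a := (1 : ℕ))]
  congr 1
  split_ifs <;> omega

/-- The order `∏ i ^ σ_i σ_i!` of the centralizer of a permutation with cycle type `σ`. -/
noncomputable def centralizerOrder (σ : ℕ+ →₀ ℕ) : ℚ :=
  σ.prod fun i n => ((i : ℕ) : ℚ) ^ n * (n.factorial : ℚ)

theorem centralizerOrder_ne_zero (σ : ℕ+ →₀ ℕ) : centralizerOrder σ ≠ 0 :=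
  Finset.prod_ne_zero_iff.2 fun i _ =>
    mul_ne_zero (pow_ne_zero _ (Nat.cast_ne_zero.2 i.pos.ne')) (Nat.cast_ne_zero.2
      (Nat.factorial_ne_zero _))

theorem centralizerOrder_zero : centralizerOrder 0 = 1 := by simp [centralizerOrder]

theorem centralizerOrder_add_single (σ : ℕ+ →₀ ℕ) (j : ℕ+) :
    centralizerOrder (σ + Finsupp.single j 1) = (j : ℕ) * (σ j + 1) * centralizerOrder σ := by
  have key : ∀ τ : ℕ+ →₀ ℕ, centralizerOrder τ =
      (((j : ℕ) : ℚ) ^ τ j * ((τ j).factorial : ℚ)) * centralizerOrder (τ.erase j) := fun τ => by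
    exact (Finsupp.mul_prod_erase' τ j (fun i n => ((i : ℕ) : ℚ) ^ n * (n.factorial : ℚ))
      (by simp)).symm
  rw [key, key σ]
  have : (σ + Finsupp.single j 1).erase j = σ.erase j := by
    rw [Finsupp.erase_add, Finsupp.erase_single, add_zero]
  rw [this]
  simp [Nat.factorial_succ, pow_succ]
  ring

theorem card_centralizer_eq (g : Equiv.Perm (Fin m)) :
    (Nat.card (Subgroup.centralizer {g}) : ℚ) = centralizerOrder (cycleExponent g) := by
  have h1 := prod_cycleExponent g fun i n => (i : ℚ) ^ n * (n.factorial : ℚ)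
  rw [centralizerOrder, h1, Equiv.Perm.nat_card_centralizer, Finset.prod_mul_distrib]
  have h2 : ∏ i ∈ g.partition.parts.toFinset, (i : ℚ) ^ g.partition.parts.count i =
      (g.cycleType.prod : ℚ) := by
    have h3 : g.partition.parts.prod = g.cycleType.prod := by
      rw [Equiv.Perm.parts_partition, Multiset.prod_add, Multiset.prod_replicate, one_pow, mul_one]
    rw [← h3, Finset.prod_multiset_count]
    push_cast
    rfl
  have hone : 1 ∉ g.cycleType.toFinset := fun h => by
    have := Equiv.Perm.two_le_of_mem_cycleType (Multiset.mem_toFinset.1 h)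
    omega
  have hcount : ∀ i, g.partition.parts.count i =
      g.cycleType.count i + if 1 = i then m - g.cycleType.sum else 0 := fun i => by
    rw [Equiv.Perm.parts_partition, Multiset.count_add, Multiset.count_replicate,
      ← Equiv.Perm.sum_cycleType, Fintype.card_fin]
  have h4 : ∏ i ∈ g.partition.parts.toFinset, ((g.partition.parts.count i).factorial : ℚ) =
      ∏ i ∈ insert 1 g.cycleType.toFinset, ((g.partition.parts.count i).factorial : ℚ) := by
    apply Finset.prod_subset
    · intro i hi
      rw [Multiset.mem_toFinset, Equiv.Perm.parts_partition, Multiset.mem_add] at hi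
      rcases hi with hi | hi
      · exact Finset.mem_insert_of_mem (Multiset.mem_toFinset.2 hi)
      · rw [Multiset.eq_of_mem_replicate hi]
        exact Finset.mem_insert_self _ _
    · intro i _ hi
      rw [Multiset.count_eq_zero_of_notMem fun h => hi (Multiset.mem_toFinset.2 h)]
      simp
  rw [h2, h4, Finset.prod_insert hone, hcount 1,
    Multiset.count_eq_zero_of_notMem fun h => hone (Multiset.mem_toFinset.2 h)]
  have h5 : ∏ i ∈ g.cycleType.toFinset, ((g.partition.parts.count i).factorial : ℚ) =
      ∏ i ∈ g.cycleType.toFinset, ((g.cycleType.count i).factorial : ℚ) := by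
    refine Finset.prod_congr rfl fun i hi => ?_
    rw [hcount, if_neg, add_zero]
    rintro rfl
    exact hone hi
  rw [h5]
  simp only [if_true, zero_add, Fintype.card_fin]
  push_cast
  ring

theorem sum_conj_eq (f : Equiv.Perm (Fin m) → ℚ) (g : Equiv.Perm (Fin m)) :
    ∑ h, f (h⁻¹ * g * h) = centralizerOrder (cycleExponent g) *
      ∑ x with cycleExponent x = cycleExponent g, f x := by
  classical
  rw [← card_centralizer_eq, Finset.mul_sum,
    ← Finset.sum_fiberwise_of_maps_to (s := Finset.univ)
      (t := Finset.univ.filter fun x => cycleExponent x = cycleExponent g)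
      (g := fun h => h⁻¹ * g * h)]
  · refine Finset.sum_congr rfl fun x hx => ?_
    rw [Finset.mem_filter, cycleExponent_eq_iff, isConj_comm, isConj_iff] at hx
    obtain ⟨-, k, hk⟩ := hx
    rw [Finset.sum_congr rfl (g := fun _ => f x) fun h hh => by rw [(Finset.mem_filter.1 hh).2],
      Finset.sum_const, nsmul_eq_mul]
    congr 2
    rw [← Nat.card_eq_finsetCard]
    refine Nat.card_congr ((Equiv.mulRight k).subtypeEquiv fun h => ?_)
    simp only [Finset.mem_filter, Finset.mem_univ, true_and, Equiv.coe_mulRight,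
      Subgroup.mem_centralizer_singleton_iff]
    rw [← hk]
    constructor
    · intro H
      calc h * k * g = h * (k * g * k⁻¹) * k := by group
        _ = g * (h * k) := by rw [← H]; group
    · intro H
      calc h⁻¹ * g * h = h⁻¹ * (g * (h * k)) * k⁻¹ := by group
        _ = k * g * k⁻¹ := by rw [← H]; group
  · intro h _
    rw [Finset.mem_filter, cycleExponent_eq_iff, isConj_comm, isConj_iff]
    exact ⟨Finset.mem_univ _, h⁻¹, by simp⟩

/-- The embedding `S_k × S_r → S_m` given by a decomposition of `Fin m`. -/
noncomputable def blockHom {k r : ℕ} (e : Fin k ⊕ Fin r ≃ Fin m) :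
    Equiv.Perm (Fin k) × Equiv.Perm (Fin r) →* Equiv.Perm (Fin m) :=
  (e.permCongrHom : _ →* _).comp (Equiv.Perm.sumCongrHom (Fin k) (Fin r))

theorem blockHom_inl {k r : ℕ} (e : Fin k ⊕ Fin r ≃ Fin m) (g : Equiv.Perm (Fin k))
    (u : Equiv.Perm (Fin r)) (a : Fin k) :
    blockHom e (g, u) (e (Sum.inl a)) = e (Sum.inl (g a)) := by
  simp [blockHom, Equiv.permCongrHom]

theorem blockHom_inr {k r : ℕ} (e : Fin k ⊕ Fin r ≃ Fin m) (g : Equiv.Perm (Fin k))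
    (u : Equiv.Perm (Fin r)) (a : Fin r) :
    blockHom e (g, u) (e (Sum.inr a)) = e (Sum.inr (u a)) := by
  simp [blockHom, Equiv.permCongrHom]

theorem cycleType_of_extends {k : ℕ} (f : Fin k ↪ Fin m) (g : Equiv.Perm (Fin k))
    (p : Equiv.Perm (Fin m)) (h1 : ∀ a, p (f a) = f (g a)) (h2 : ∀ x, x ∉ Set.range f → p x = x) :
    p.cycleType = g.cycleType := by
  classical
  have : p = g.extendDomain (Equiv.ofInjective f f.injective) := by
    ext1 x
    by_cases hx : x ∈ Set.range f
    · obtain ⟨a, rfl⟩ := hx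
      rw [h1]
      exact (Equiv.Perm.extendDomain_apply_image g (Equiv.ofInjective f f.injective) a).symm
    · rw [h2 x hx, Equiv.Perm.extendDomain_apply_not_subtype _ _ hx]
  rw [this, Equiv.Perm.cycleType_extendDomain]

theorem cycleExponent_blockHom {k r : ℕ} (e : Fin k ⊕ Fin r ≃ Fin m) (g : Equiv.Perm (Fin k))
    (u : Equiv.Perm (Fin r)) :
    cycleExponent (blockHom e (g, u)) = cycleExponent g + cycleExponent u := by
  have hkr : k + r = m := by simpa using Fintype.card_congr e
  have hl : (blockHom e (g, 1)).cycleType = g.cycleType := by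
    refine cycleType_of_extends (Function.Embedding.inl.trans e.toEmbedding) g _
      (fun a => blockHom_inl e g 1 a) fun x hx => ?_
    obtain ⟨a | b, rfl⟩ := e.surjective x
    · exact absurd ⟨a, rfl⟩ hx
    · exact blockHom_inr e g 1 b
  have hr : (blockHom e (1, u)).cycleType = u.cycleType := by
    refine cycleType_of_extends (Function.Embedding.inr.trans e.toEmbedding) u _
      (fun a => blockHom_inr e 1 u a) fun x hx => ?_
    obtain ⟨a | b, rfl⟩ := e.surjective x
    · exact blockHom_inl e 1 u a
    · exact absurd ⟨b, rfl⟩ hx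
  have hdis : Equiv.Perm.Disjoint (blockHom e (g, 1)) (blockHom e (1, u)) := by
    intro x
    obtain ⟨a | b, rfl⟩ := e.surjective x
    · exact Or.inr (blockHom_inl e 1 u a)
    · exact Or.inl (blockHom_inr e g 1 b)
  have hct : (blockHom e (g, u)).cycleType = g.cycleType + u.cycleType := by
    rw [← hl, ← hr, ← hdis.cycleType_mul, ← map_mul, Prod.mk_mul_mk, mul_one, one_mul]
  ext i
  rw [Finsupp.add_apply, cycleExponent_apply, cycleExponent_apply, cycleExponent_apply,
    numCycles_eq, numCycles_eq, numCycles_eq, hct, Multiset.count_add, Multiset.sum_add]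
  have h1 := g.sum_cycleType_le
  have h2 := u.sum_cycleType_le
  rw [Fintype.card_fin] at h1 h2
  split_ifs <;> omega

end CycleExponent

end SymmetricRep

namespace SymmetricRep

open MvPolynomial

/-! ### The ring of power sums -/

section PowerSums

/-- The pairing on `ℚ[p₁, p₂, …]` for which the monomials are orthogonal and `⟨p^σ, p^σ⟩` is the
order of the centralizer of a permutation with cycle type `σ`. -/
noncomputable def pairing : MvPolynomial ℕ+ ℚ →ₗ[ℚ] MvPolynomial ℕ+ ℚ →ₗ[ℚ] ℚ :=
  (basisMonomials ℕ+ ℚ).constr ℚ fun σ => centralizerOrder σ • lcoeff ℚ σ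

theorem pairing_monomial (σ : ℕ+ →₀ ℕ) (a : ℚ) (G : MvPolynomial ℕ+ ℚ) :
    pairing (monomial σ a) G = a * (centralizerOrder σ * coeff σ G) := by
  have h1 : monomial σ a = a • basisMonomials ℕ+ ℚ σ := by
    rw [coe_basisMonomials, smul_monomial, smul_eq_mul, mul_one]
  rw [h1, map_smul, pairing, Module.Basis.constr_basis]
  simp [lcoeff_apply]

theorem pairing_comm (F G : MvPolynomial ℕ+ ℚ) : pairing F G = pairing G F := by
  classical
  induction F using MvPolynomial.induction_on' with
  | add p q hp hq => rw [map_add, map_add, LinearMap.add_apply, hp, hq]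
  | monomial σ a =>
    induction G using MvPolynomial.induction_on' with
    | add p q hp hq => rw [map_add, map_add, LinearMap.add_apply, hp, hq]
    | monomial τ b =>
      rw [pairing_monomial, pairing_monomial, coeff_monomial, coeff_monomial]
      by_cases h : σ = τ
      · subst h
        simp only [if_true]
        ring
      · rw [if_neg (Ne.symm h), if_neg h]
        ring

theorem eq_zero_of_pairing_eq_zero {G : MvPolynomial ℕ+ ℚ} (h : ∀ F, pairing F G = 0) : G = 0 := by
  ext σ
  have := h (monomial σ 1)
  rw [pairing_monomial, one_mul] at this
  simpa using (mul_eq_zero.1 this).resolve_left (centralizerOrder_ne_zero σ)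

theorem pairing_X_mul (j : ℕ+) (F G : MvPolynomial ℕ+ ℚ) :
    pairing (X j * F) G = pairing F (((j : ℕ) : ℚ) • pderiv j G) := by
  induction F using MvPolynomial.induction_on' with
  | add p q hp hq => rw [mul_add, map_add, map_add, LinearMap.add_apply, hp, hq,
      LinearMap.add_apply]
  | monomial σ a =>
    rw [X, monomial_mul, one_mul, pairing_monomial, pairing_monomial, coeff_smul, coeff_pderiv,
      add_comm (Finsupp.single j 1) σ, centralizerOrder_add_single, smul_eq_mul]
    ring

/-- The cycle index polynomial of an element of the group algebra. -/
noncomputable def cyclePoly {m : ℕ} : GroupAlg m →ₗ[ℚ] MvPolynomial ℕ+ ℚ where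
  toFun x := ∑ g, monomial (cycleExponent g) (x.coeff g)
  map_add' x y := by simp [Finset.sum_add_distrib]
  map_smul' a x := by simp [Finset.smul_sum, smul_monomial]

theorem cyclePoly_apply {m : ℕ} (x : GroupAlg m) :
    cyclePoly x = ∑ g, monomial (cycleExponent g) (x.coeff g) := rfl

theorem cyclePoly_single {m : ℕ} (g : Equiv.Perm (Fin m)) (a : ℚ) :
    cyclePoly (MonoidAlgebra.single g a) = monomial (cycleExponent g) a := by
  rw [cyclePoly_apply, Finset.sum_eq_single g]
  · simp
  · intro k _ hk
    simp [hk.symm]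
  · simp

theorem coeff_cyclePoly {m : ℕ} (x : GroupAlg m) (σ : ℕ+ →₀ ℕ) :
    coeff σ (cyclePoly x) = ∑ g with cycleExponent g = σ, x.coeff g := by
  classical
  rw [cyclePoly_apply, coeff_sum, Finset.sum_filter]
  simp only [coeff_monomial]

/-- The normalized sum of all permutations of `Fin r`. -/
noncomputable def averageElt (r : ℕ) : GroupAlg r :=
  ∑ u, MonoidAlgebra.single u ((r.factorial : ℚ)⁻¹)

theorem coeff_averageElt (r : ℕ) (u : Equiv.Perm (Fin r)) :
    (averageElt r).coeff u = (r.factorial : ℚ)⁻¹ := by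
  simp [averageElt, MonoidAlgebra.coeff_sum, Finsupp.single_apply]

/-- The complete homogeneous symmetric function `h_r` in terms of power sums. -/
noncomputable def complete (r : ℕ) : MvPolynomial ℕ+ ℚ := cyclePoly (averageElt r)

theorem coeff_complete (r : ℕ) (σ : ℕ+ →₀ ℕ) :
    coeff σ (complete r) = if cycleWeight σ = r then (centralizerOrder σ)⁻¹ else 0 := by
  classical
  rw [complete, coeff_cyclePoly]
  split_ifs with h
  · obtain ⟨g, rfl⟩ := exists_cycleExponent_eq h
    have h1 := sum_conj_eq (fun _ => (r.factorial : ℚ)⁻¹) g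
    simp only [Finset.sum_const, Finset.card_univ, Fintype.card_perm, Fintype.card_fin,
      nsmul_eq_mul] at h1
    rw [mul_inv_cancel₀ (Nat.cast_ne_zero.2 r.factorial_ne_zero)] at h1
    simp only [coeff_averageElt, Finset.sum_const, nsmul_eq_mul]
    exact eq_inv_of_mul_eq_one_right h1.symm
  · apply Finset.sum_eq_zero
    intro g hg
    rw [← (Finset.mem_filter.1 hg).2] at h
    exact absurd (cycleWeight_cycleExponent g) h

theorem pderiv_complete (j : ℕ+) (r : ℕ) :
    ((j : ℕ) : ℚ) • pderiv j (complete r) =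
      if (j : ℕ) ≤ r then complete (r - j) else 0 := by
  ext σ
  have hw : cycleWeight (σ + Finsupp.single j 1) = cycleWeight σ + j := by
    rw [map_add]
    simp [Finsupp.weight_single]
  rw [coeff_smul, coeff_pderiv, coeff_complete, hw, centralizerOrder_add_single]
  have h1 := centralizerOrder_ne_zero σ
  have h2 : (((j : ℕ) : ℚ)) ≠ 0 := Nat.cast_ne_zero.2 j.pos.ne'
  have h3 : ((σ j : ℚ) + 1) ≠ 0 := by positivity
  split_ifs with h4 h5 h5
  · rw [coeff_complete, if_pos (by omega), smul_eq_mul]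
    field_simp
  · omega
  · rw [coeff_complete, if_neg (by omega)]
    simp
  · simp

/-- The substitution `p_i ↦ p_i + u ^ i`. -/
noncomputable def shift : MvPolynomial ℕ+ ℚ →ₐ[ℚ] Polynomial (MvPolynomial ℕ+ ℚ) :=
  aeval fun i : ℕ+ => Polynomial.C (X i) + Polynomial.X ^ (i : ℕ)

/-- The operator adjoint to the multiplication by `h_r`. -/
noncomputable def skew (r : ℕ) (G : MvPolynomial ℕ+ ℚ) : MvPolynomial ℕ+ ℚ := (shift G).coeff r

theorem skew_add (r : ℕ) (F G : MvPolynomial ℕ+ ℚ) : skew r (F + G) = skew r F + skew r G := by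
  simp [skew]

theorem skew_mul (r : ℕ) (F G : MvPolynomial ℕ+ ℚ) :
    skew r (F * G) = ∑ x ∈ Finset.HasAntidiagonal.antidiagonal r, skew x.1 F * skew x.2 G := by
  simp [skew, Polynomial.coeff_mul]

theorem skew_C (r : ℕ) (a : ℚ) : skew r (C a) = if r = 0 then C a else 0 := by
  have : shift (C a) = Polynomial.C (C a) := by
    rw [shift, aeval_C]
    rfl
  rw [skew, this, Polynomial.coeff_C]

theorem skew_mul_X (r : ℕ) (G : MvPolynomial ℕ+ ℚ) (j : ℕ+) :
    skew r (G * X j) = skew r G * X j + if (j : ℕ) ≤ r then skew (r - j) G else 0 := by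
  rw [skew, map_mul]
  have : shift (X j) = Polynomial.C (X j) + Polynomial.X ^ (j : ℕ) := by
    rw [shift, aeval_X]
  rw [this, mul_add, Polynomial.coeff_add, Polynomial.coeff_mul_C, Polynomial.coeff_mul_X_pow']
  rfl

theorem pairing_complete_mul (r : ℕ) (F G : MvPolynomial ℕ+ ℚ) :
    pairing (complete r * F) G = pairing F (skew r G) := by
  induction G using MvPolynomial.induction_on generalizing F r with
  | C a =>
    rw [pairing_comm, skew_C, C_apply, pairing_monomial]
    have h0 : coeff 0 (complete r * F) = (if r = 0 then 1 else 0) * coeff 0 F := by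
      rw [← constantCoeff_eq, map_mul, constantCoeff_eq, coeff_complete]
      simp [centralizerOrder_zero, eq_comm]
    rw [h0]
    split_ifs with h
    · rw [pairing_comm, pairing_monomial, one_mul]
    · simp
  | add p q hp hq => rw [map_add, hp, hq, skew_add, map_add]
  | mul_X p j ih =>
    rw [pairing_comm, mul_comm p, pairing_X_mul, pderiv_mul, smul_add, map_add, ← smul_mul_assoc,
      pderiv_complete, mul_comm _ p, skew_mul_X, map_add, pairing_comm F (_ * X j), mul_comm _ (X j),
      pairing_X_mul, ← mul_smul_comm, pairing_comm p (complete r * _), ih, add_comm,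
      pairing_comm (skew r p)]
    congr 1
    split_ifs with h
    · rw [pairing_comm, ih]
    · simp

theorem pairing_complete_right (ρ : ℕ+ →₀ ℕ) (a : ℚ) (s : ℕ) :
    pairing (monomial ρ a) (complete s) = if cycleWeight ρ = s then a else 0 := by
  rw [pairing_monomial, coeff_complete]
  split_ifs
  · rw [mul_inv_cancel₀ (centralizerOrder_ne_zero ρ), mul_one]
  · simp

theorem skew_complete (r s : ℕ) :
    skew r (complete s) = if r ≤ s then complete (s - r) else 0 := by
  rw [← sub_eq_zero]
  refine eq_zero_of_pairing_eq_zero fun F => ?_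
  rw [map_sub, ← pairing_complete_mul, sub_eq_zero]
  induction F using MvPolynomial.induction_on' with
  | add p q hp hq => rw [mul_add, map_add, map_add, LinearMap.add_apply, hp, hq,
      LinearMap.add_apply]
  | monomial ρ a =>
    have h1 : pairing (complete r * monomial ρ a) (complete s) =
        if r + cycleWeight ρ = s then a else 0 := by
      conv_lhs => rw [complete, cyclePoly_apply, Finset.sum_mul, map_sum, LinearMap.sum_apply]
      simp only [monomial_mul, pairing_complete_right, map_add, cycleWeight_cycleExponent,
        coeff_averageElt, Finset.sum_const, Finset.card_univ, Fintype.card_perm, Fintype.card_fin,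
        nsmul_eq_mul]
      split_ifs
      · rw [← mul_assoc, mul_inv_cancel₀ (Nat.cast_ne_zero.2 r.factorial_ne_zero), one_mul]
      · simp
    rw [h1]
    split_ifs with h2 h3 h3
    · rw [pairing_complete_right, if_pos (by omega)]
    · omega
    · rw [pairing_complete_right, if_neg (by omega)]
    · simp

/-- The norm of `h_r F`, computed by moving one factor `h_r` across the pairing. -/
theorem pairing_complete_mul_self (r : ℕ) (F : MvPolynomial ℕ+ ℚ) :
    pairing (complete r * F) (complete r * F) =
      ∑ j ∈ Finset.range (r + 1), pairing (skew j F) (skew j F) := by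
  rw [pairing_complete_mul, skew_mul, map_sum, Finset.Nat.sum_antidiagonal_eq_sum_range_succ_mk,
    ← Finset.sum_range_reflect]
  refine Finset.sum_congr rfl fun j hj => ?_
  rw [Finset.mem_range] at hj
  rw [skew_complete, if_pos (by omega), pairing_comm, pairing_complete_mul]
  have h1 : r - (r + 1 - 1 - j) = j := by omega
  rw [h1]

end PowerSums

end SymmetricRep

namespace SymmetricRep

open MvPolynomial

/-! ### Young diagrams with given row lengths -/

section Diagrams

/-- The Young diagram with row lengths `f 0 ≥ f 1 ≥ …`, where `f i = 0` for `i ≥ B`. -/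
def diagramOfRowLen (f : ℕ → ℕ) (hf : Antitone f) (B : ℕ) : YoungDiagram where
  cells := (Finset.range B ×ˢ Finset.range (f 0)).filter fun c => c.2 < f c.1
  isLowerSet := by
    rintro ⟨i, j⟩ ⟨i', j'⟩ hle hmem
    obtain ⟨h1, h2⟩ := Prod.mk_le_mk.mp hle
    simp only [Finset.coe_filter, Finset.mem_product, Finset.mem_range, Set.mem_ofPred_eq]
      at hmem ⊢
    have := hf h1
    omega

theorem rowLen_diagramOfRowLen {f : ℕ → ℕ} (hf : Antitone f) {B : ℕ} (hB : f B = 0) (i : ℕ) :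
    (diagramOfRowLen f hf B).rowLen i = f i := by
  have key : ∀ j, j < (diagramOfRowLen f hf B).rowLen i ↔ j < f i := fun j => by
    rw [← YoungDiagram.mem_iff_lt_rowLen, ← YoungDiagram.mem_cells, diagramOfRowLen]
    simp only [Finset.mem_filter, Finset.mem_product, Finset.mem_range]
    have h0 := hf (Nat.zero_le i)
    refine ⟨fun h => h.2, fun h => ⟨⟨?_, by omega⟩, h⟩⟩
    by_contra hi
    have := hf (not_lt.1 hi)
    omega
  have h1 := key (f i)
  have h2 := key ((diagramOfRowLen f hf B).rowLen i)
  omega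

theorem card_eq_sum_rowLen (μ : YoungDiagram) {B : ℕ} (hB : μ.rowLen B = 0) :
    μ.card = ∑ i ∈ Finset.range B, μ.rowLen i := by
  change μ.cells.card = _
  rw [Finset.card_eq_sum_card_fiberwise (f := Prod.fst) (t := Finset.range B)]
  · refine Finset.sum_congr rfl fun i _ => ?_
    rw [YoungDiagram.rowLen_eq_card]
    rfl
  · rintro ⟨i, j⟩ hc
    have h1 : j < μ.rowLen i := YoungDiagram.mem_iff_lt_rowLen.1 hc
    rw [Finset.mem_coe, Finset.mem_range]
    by_contra hi
    have := μ.rowLen_anti B i (not_lt.1 hi)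
    omega

theorem rowLen_card_eq_zero (μ : YoungDiagram) {B : ℕ} (hB : μ.card ≤ B) : μ.rowLen B = 0 := by
  by_contra h
  have h1 : (Finset.range (B + 1)).card ≤ μ.cells.card := by
    refine Finset.card_le_card_of_injOn (fun i => (i, 0)) ?_ ?_
    · intro i hi
      rw [Finset.mem_coe, Finset.mem_range] at hi
      have := μ.rowLen_anti i B (by omega)
      exact YoungDiagram.mem_iff_lt_rowLen.2 (by omega)
    · intro i _ j _ hij
      exact (Prod.mk.injEq _ _ _ _ ▸ hij).1
  rw [Finset.card_range] at h1
  have h2 : μ.cells.card = μ.card := rfl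
  omega

theorem finite_diagrams (m : ℕ) : Finite {μ : YoungDiagram // μ.card ≤ m} := by
  have hf : Function.Injective fun μ : {μ : YoungDiagram // μ.card ≤ m} =>
      fun i : Fin m => (⟨min (μ.1.rowLen i) m, by omega⟩ : Fin (m + 1)) := by
    intro μ ν h
    refine Subtype.ext (eq_of_rowLen_eq fun i => ?_)
    have hle : ∀ μ : YoungDiagram, μ.card ≤ m → μ.rowLen i ≤ m := fun μ hμ => by
      rw [YoungDiagram.rowLen_eq_card]
      exact (Finset.card_le_card (Finset.filter_subset _ _)).trans hμ
    by_cases hi : i < m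
    · have h1 := congrArg Fin.val (congrFun h ⟨i, hi⟩)
      have h2 := hle μ.1 μ.2
      have h3 := hle ν.1 ν.2
      simp only at h1
      omega
    · rw [rowLen_card_eq_zero μ.1 (μ.2.trans (not_lt.1 hi)),
        rowLen_card_eq_zero ν.1 (ν.2.trans (not_lt.1 hi))]
  exact Finite.of_injective _ hf

/-- The Young diagrams with `m` cells. -/
abbrev Diagram (m : ℕ) : Type := {μ : YoungDiagram // μ.card = m}

noncomputable instance (m : ℕ) : Fintype (Diagram m) := by
  have := finite_diagrams m
  have : Finite (Diagram m) := Finite.of_injective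
    (fun μ : Diagram m => (⟨μ.1, μ.2.le⟩ : {μ : YoungDiagram // μ.card ≤ m}))
    fun μ ν h => Subtype.ext (congrArg (fun x => x.1) h)
  exact Fintype.ofFinite _

noncomputable instance (m : ℕ) : DecidableEq (Diagram m) := Classical.decEq _

theorem le_cycleWeight {σ : ℕ+ →₀ ℕ} {i : ℕ+} (hi : i ∈ σ.support) : (i : ℕ) ≤ cycleWeight σ := by
  rw [cycleWeight, Finsupp.weight_apply, Finsupp.sum]
  refine le_trans ?_ (Finset.single_le_sum (f := fun i : ℕ+ => σ i • (i : ℕ))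
    (fun _ _ => Nat.zero_le _) hi)
  rw [Finsupp.mem_support_iff] at hi
  exact Nat.le_mul_of_pos_left _ (Nat.pos_of_ne_zero hi)

/-- The number of parts of `σ` of size larger than `j`. -/
noncomputable def partsAbove (σ : ℕ+ →₀ ℕ) (j : ℕ) : ℕ :=
  ∑ i ∈ σ.support.filter fun i : ℕ+ => j < (i : ℕ), σ i

theorem partsAbove_antitone (σ : ℕ+ →₀ ℕ) : Antitone (partsAbove σ) := by
  intro a b hab
  refine Finset.sum_le_sum_of_subset fun i hi => ?_
  rw [Finset.mem_filter] at hi ⊢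
  exact ⟨hi.1, hab.trans_lt hi.2⟩

theorem partsAbove_eq_zero {σ : ℕ+ →₀ ℕ} {B : ℕ} (hB : cycleWeight σ ≤ B) :
    partsAbove σ B = 0 := by
  rw [partsAbove, Finset.filter_false_of_mem, Finset.sum_empty]
  intro i hi
  have := le_cycleWeight hi
  omega

theorem partsAbove_pred (σ : ℕ+ →₀ ℕ) (i : ℕ+) :
    partsAbove σ ((i : ℕ) - 1) = partsAbove σ i + σ i := by
  rw [partsAbove, partsAbove, Finset.sum_filter, Finset.sum_filter]
  have h1 : σ i = ∑ k ∈ σ.support, if k = i then σ k else 0 := by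
    rw [Finset.sum_ite_eq' σ.support i fun k => σ k]
    simp +contextual
  conv_rhs => rw [h1]
  rw [← Finset.sum_add_distrib]
  refine Finset.sum_congr rfl fun k _ => ?_
  have hi := i.pos
  by_cases hk : k = i
  · subst hk
    rw [if_pos (by omega), if_neg (by omega), if_pos rfl, zero_add]
  · have hk' : (k : ℕ) ≠ i := fun h => hk (PNat.coe_injective h)
    rw [if_neg hk, add_zero]
    exact if_congr (by omega) rfl rfl

theorem sum_partsAbove {σ : ℕ+ →₀ ℕ} {B : ℕ} (hB : cycleWeight σ ≤ B) :
    ∑ j ∈ Finset.range B, partsAbove σ j = cycleWeight σ := by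
  simp only [partsAbove, Finset.sum_filter]
  rw [Finset.sum_comm, cycleWeight, Finsupp.weight_apply, Finsupp.sum]
  refine Finset.sum_congr rfl fun i hi => ?_
  have h1 := (le_cycleWeight hi).trans hB
  rw [← Finset.sum_filter, Finset.sum_const, smul_eq_mul, smul_eq_mul, mul_comm]
  congr 1
  have : (Finset.range B).filter (fun j => j < (i : ℕ)) = Finset.range i := by
    ext j
    simp only [Finset.mem_filter, Finset.mem_range]
    omega
  rw [this, Finset.card_range]

/-- The cycle types of permutations of `m` points. -/
abbrev CycleType (m : ℕ) : Type := {σ : ℕ+ →₀ ℕ // cycleWeight σ = m}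

theorem exists_injective_cycleType (m : ℕ) :
    ∃ f : CycleType m → Diagram m, Function.Injective f := by
  have hcard : ∀ σ : CycleType m,
      (diagramOfRowLen (partsAbove σ.1) (partsAbove_antitone σ.1) m).card = m := fun σ => by
    have h0 := partsAbove_eq_zero σ.2.le
    rw [card_eq_sum_rowLen _ (B := m) (by rw [rowLen_diagramOfRowLen _ h0, h0])]
    simp only [rowLen_diagramOfRowLen _ h0]
    rw [sum_partsAbove σ.2.le, σ.2]
  refine ⟨fun σ => ⟨_, hcard σ⟩, fun σ τ h => ?_⟩
  have h1 : ∀ j, partsAbove σ.1 j = partsAbove τ.1 j := fun j => by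
    have := congrArg (fun μ : Diagram m => μ.1.rowLen j) h
    simpa only [rowLen_diagramOfRowLen _ (partsAbove_eq_zero σ.2.le),
      rowLen_diagramOfRowLen _ (partsAbove_eq_zero τ.2.le)] using this
  refine Subtype.ext (Finsupp.ext fun i => ?_)
  have h2 := partsAbove_pred σ.1 i
  have h3 := partsAbove_pred τ.1 i
  rw [h1, h1 i] at h2
  omega

instance (m : ℕ) : Finite (CycleType m) :=
  let ⟨_, hf⟩ := exists_injective_cycleType m
  Finite.of_injective _ hf

end Diagrams

/-! ### Schur functions -/

section Schur

variable {m : ℕ}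

/-- The Frobenius characteristic of the simple module `V_μ`. -/
noncomputable def schur (μ : Diagram m) : MvPolynomial ℕ+ ℚ :=
  cyclePoly (youngIdempotent μ.1 μ.2)

theorem traceOn_simpleModule_single (μ : Diagram m) (g : Equiv.Perm (Fin m)) :
    traceOn (simpleModule μ.1 μ.2) (MonoidAlgebra.single g 1) =
      pairing (schur μ) (monomial (cycleExponent g) 1) := by
  rw [simpleModule_eq, traceOn_span_idempotent_single (youngIdempotent_mul_self μ.1 μ.2),
    sum_conj_eq, cycleExponent_inv, pairing_comm, pairing_monomial, schur, coeff_cyclePoly, one_mul]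

theorem traceOn_simpleModule (μ : Diagram m) (x : GroupAlg m) :
    traceOn (simpleModule μ.1 μ.2) x = pairing (schur μ) (cyclePoly x) := by
  rw [eq_sum_single x, map_sum, map_sum, map_sum]
  refine Finset.sum_congr rfl fun g _ => ?_
  rw [map_smul, map_smul, map_smul, traceOn_simpleModule_single, cyclePoly_single]

theorem pairing_schur (μ ν : Diagram m) : pairing (schur μ) (schur ν) = if μ = ν then 1 else 0 := by
  rw [schur.eq_def ν, ← traceOn_simpleModule]
  split_ifs with h
  · subst h
    exact traceOn_simpleModule_self
  · exact traceOn_simpleModule_of_ne fun h' => h (Subtype.ext h'.symm)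

/-- The homogeneous polynomials of degree `m`, where `p_i` has degree `i`. -/
noncomputable def homogeneousPart (m : ℕ) : Submodule ℚ (MvPolynomial ℕ+ ℚ) :=
  Submodule.span ℚ (Set.range fun σ : CycleType m => monomial σ.1 (1 : ℚ))

theorem monomial_mem_homogeneousPart {σ : ℕ+ →₀ ℕ} (hσ : cycleWeight σ = m) (a : ℚ) :
    monomial σ a ∈ homogeneousPart m := by
  have : monomial σ a = a • monomial σ (1 : ℚ) := by simp [smul_monomial]
  rw [this]
  exact Submodule.smul_mem _ _ (Submodule.subset_span ⟨⟨σ, hσ⟩, rfl⟩)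

theorem cyclePoly_mem (x : GroupAlg m) : cyclePoly x ∈ homogeneousPart m :=
  Submodule.sum_mem _ fun g _ => monomial_mem_homogeneousPart (cycleWeight_cycleExponent g) _

theorem schur_mem (μ : Diagram m) : schur μ ∈ homogeneousPart m := cyclePoly_mem _

theorem linearIndependent_schur (m : ℕ) :
    LinearIndependent ℚ (fun μ : Diagram m => schur μ) := by
  rw [Fintype.linearIndependent_iff]
  intro a ha μ
  have h1 := congrArg (pairing (schur μ)) ha
  simpa [map_sum, pairing_schur] using h1

theorem span_schur (m : ℕ) :
    Submodule.span ℚ (Set.range fun μ : Diagram m => schur μ) = homogeneousPart m := by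
  have := Fintype.ofFinite (CycleType m)
  have : FiniteDimensional ℚ (homogeneousPart m) :=
    FiniteDimensional.span_of_finite ℚ (Set.finite_range _)
  refine Submodule.eq_of_le_of_finrank_le ?_ ?_
  · rw [Submodule.span_le]
    rintro _ ⟨μ, rfl⟩
    exact schur_mem μ
  · rw [finrank_span_eq_card (linearIndependent_schur m)]
    obtain ⟨f, hf⟩ := exists_injective_cycleType m
    exact (finrank_range_le_card _).trans (Fintype.card_le_of_injective f hf)

theorem eq_sum_schur {F : MvPolynomial ℕ+ ℚ} (hF : F ∈ homogeneousPart m) :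
    F = ∑ μ : Diagram m, pairing (schur μ) F • schur μ := by
  rw [← span_schur, Submodule.mem_span_range_iff_exists_fun] at hF
  obtain ⟨a, rfl⟩ := hF
  refine Finset.sum_congr rfl fun μ _ => ?_
  simp [map_sum, pairing_schur]

theorem pairing_self_eq_sum {F : MvPolynomial ℕ+ ℚ} (hF : F ∈ homogeneousPart m) :
    pairing F F = ∑ μ : Diagram m, pairing (schur μ) F ^ 2 := by
  refine (congrArg (pairing F) (eq_sum_schur hF)).trans ?_
  rw [map_sum]
  refine Finset.sum_congr rfl fun μ _ => ?_
  rw [map_smul, smul_eq_mul, pairing_comm F, pow_two]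

theorem mul_mem_homogeneousPart {k r : ℕ} {F G : MvPolynomial ℕ+ ℚ} (hF : F ∈ homogeneousPart k)
    (hG : G ∈ homogeneousPart r) : F * G ∈ homogeneousPart (k + r) := by
  have h := Submodule.mul_mem_mul hF hG
  rw [homogeneousPart, homogeneousPart, Submodule.span_mul_span] at h
  refine Submodule.span_le.2 ?_ h
  rintro _ ⟨_, ⟨σ, rfl⟩, _, ⟨τ, rfl⟩, rfl⟩
  simp only [monomial_mul]
  exact monomial_mem_homogeneousPart (by rw [map_add, σ.2, τ.2]) _

theorem complete_mem (r : ℕ) : complete r ∈ homogeneousPart r := cyclePoly_mem _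

end Schur

end SymmetricRep

namespace SymmetricRep

open MvPolynomial

/-! ### Horizontal strips -/

/-- The skew shape `ν / lam` is a horizontal strip. -/
def IsHorizontalStrip (ν lam : YoungDiagram) : Prop :=
  ∀ i, lam.rowLen i ≤ ν.rowLen i ∧ ν.rowLen (i + 1) ≤ lam.rowLen i

section Block

variable {k r m : ℕ}

/-- The embedding `ℚ[S_k] → ℚ[S_m]` given by a decomposition of `Fin m`. -/
noncomputable def blockLeft (e : Fin k ⊕ Fin r ≃ Fin m) : GroupAlg k →ₐ[ℚ] GroupAlg m :=
  MonoidAlgebra.mapDomainAlgHom ℚ ℚ ((blockHom e).comp (MonoidHom.inl _ _))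

/-- The embedding `ℚ[S_r] → ℚ[S_m]` given by a decomposition of `Fin m`. -/
noncomputable def blockRight (e : Fin k ⊕ Fin r ≃ Fin m) : GroupAlg r →ₐ[ℚ] GroupAlg m :=
  MonoidAlgebra.mapDomainAlgHom ℚ ℚ ((blockHom e).comp (MonoidHom.inr _ _))

theorem blockLeft_single (e : Fin k ⊕ Fin r ≃ Fin m) (g : Equiv.Perm (Fin k)) (a : ℚ) :
    blockLeft e (MonoidAlgebra.single g a) = MonoidAlgebra.single (blockHom e (g, 1)) a := by
  simp [blockLeft]

theorem blockRight_single (e : Fin k ⊕ Fin r ≃ Fin m) (u : Equiv.Perm (Fin r)) (a : ℚ) :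
    blockRight e (MonoidAlgebra.single u a) = MonoidAlgebra.single (blockHom e (1, u)) a := by
  simp [blockRight]

theorem blockLeft_mul_blockRight_single (e : Fin k ⊕ Fin r ≃ Fin m) (g : Equiv.Perm (Fin k))
    (u : Equiv.Perm (Fin r)) (a b : ℚ) :
    blockLeft e (MonoidAlgebra.single g a) * blockRight e (MonoidAlgebra.single u b) =
      MonoidAlgebra.single (blockHom e (g, u)) (a * b) := by
  rw [blockLeft_single, blockRight_single, MonoidAlgebra.single_mul_single, ← map_mul]
  simp

theorem blockRight_mul_blockLeft_single (e : Fin k ⊕ Fin r ≃ Fin m) (g : Equiv.Perm (Fin k))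
    (u : Equiv.Perm (Fin r)) (a b : ℚ) :
    blockRight e (MonoidAlgebra.single u b) * blockLeft e (MonoidAlgebra.single g a) =
      MonoidAlgebra.single (blockHom e (g, u)) (a * b) := by
  rw [blockLeft_single, blockRight_single, MonoidAlgebra.single_mul_single, ← map_mul, mul_comm b]
  simp

theorem blockLeft_blockRight_comm (e : Fin k ⊕ Fin r ≃ Fin m) (x : GroupAlg k) (y : GroupAlg r) :
    blockRight e y * blockLeft e x = blockLeft e x * blockRight e y := by
  induction x using MonoidAlgebra.induction_linear with
  | zero => simp
  | add x x' hx hx' => rw [map_add, mul_add, add_mul, hx, hx']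
  | single g a =>
    induction y using MonoidAlgebra.induction_linear with
    | zero => simp
    | add y y' hy hy' => rw [map_add, mul_add, add_mul, hy, hy']
    | single u b => rw [blockLeft_mul_blockRight_single, blockRight_mul_blockLeft_single]

theorem cyclePoly_block (e : Fin k ⊕ Fin r ≃ Fin m) (x : GroupAlg k) (y : GroupAlg r) :
    cyclePoly (blockLeft e x * blockRight e y) = cyclePoly x * cyclePoly y := by
  induction x using MonoidAlgebra.induction_linear with
  | zero => simp
  | add x x' hx hx' => rw [map_add, map_add, add_mul, add_mul, map_add, hx, hx']
  | single g a =>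
    induction y using MonoidAlgebra.induction_linear with
    | zero => simp
    | add y y' hy hy' => rw [map_add, map_add, mul_add, mul_add, map_add, hy, hy']
    | single u b =>
      rw [blockLeft_mul_blockRight_single, cyclePoly_single, cyclePoly_single, cyclePoly_single,
        monomial_mul, cycleExponent_blockHom]

theorem averageElt_mul_self (r : ℕ) : averageElt r * averageElt r = averageElt r := by
  ext g
  rw [coeff_mul_eq_sum]
  simp only [coeff_averageElt, Finset.sum_const, Finset.card_univ, Fintype.card_perm,
    Fintype.card_fin, nsmul_eq_mul]
  rw [← mul_assoc, mul_inv_cancel₀ (Nat.cast_ne_zero.2 r.factorial_ne_zero), one_mul]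

theorem block_idempotent (e : Fin k ⊕ Fin r ≃ Fin m) {x : GroupAlg k} (hx : x * x = x) :
    (blockLeft e x * blockRight e (averageElt r)) * (blockLeft e x * blockRight e (averageElt r)) =
      blockLeft e x * blockRight e (averageElt r) := by
  rw [mul_assoc, ← mul_assoc (blockRight e _), blockLeft_blockRight_comm, mul_assoc, ← map_mul,
    averageElt_mul_self, ← mul_assoc, ← map_mul, hx]

end Block

section Pieri

variable {k r m : ℕ}

theorem exists_block_decomposition (lam : Diagram k) (ν : Diagram m) (hm : k + r = m)
    (hsub : lam.1 ≤ ν.1) : ∃ e : Fin k ⊕ Fin r ≃ Fin m,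
      (∀ a, (tableau ν.1 ν.2 (e (Sum.inl a))).1 = (tableau lam.1 lam.2 a).1) ∧
      ∀ b, (tableau ν.1 ν.2 (e (Sum.inr b))).1 ∉ lam.1.cells := by
  classical
  let f : Fin k → Fin m := fun a => (tableau ν.1 ν.2).symm
    ⟨(tableau lam.1 lam.2 a).1, YoungDiagram.cells_subset_iff.2 hsub (tableau lam.1 lam.2 a).2⟩
  have hfa : ∀ a, (tableau ν.1 ν.2 (f a)).1 = (tableau lam.1 lam.2 a).1 := fun a => by simp [f]
  have hf : Function.Injective f := fun a b hab => by
    have h1 := hfa a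
    rw [hab, hfa b] at h1
    exact (tableau lam.1 lam.2).injective (Subtype.ext h1.symm)
  have hcard : Fintype.card (Fin r) = Fintype.card ↥((Set.range f)ᶜ) := by
    rw [Fintype.card_compl_set, Set.card_range_of_injective hf]
    simp only [Fintype.card_fin]
    omega
  let e : Fin k ⊕ Fin r ≃ Fin m :=
    ((Equiv.ofInjective f hf).sumCongr (Fintype.equivOfCardEq hcard)).trans
      (Equiv.Set.sumCompl (Set.range f))
  have he : ∀ a, e (Sum.inl a) = f a := fun a => by simp [e]
  refine ⟨e, fun a => by rw [he, hfa], fun b hb => ?_⟩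
  have h1 : e (Sum.inr b) = f ((tableau lam.1 lam.2).symm ⟨_, hb⟩) := by
    apply (tableau ν.1 ν.2).injective
    apply Subtype.ext
    rw [hfa, Equiv.apply_symm_apply]
  rw [← he] at h1
  exact absurd (e.injective h1) (by simp)

variable {lam : Diagram k} {ν : Diagram m} {e : Fin k ⊕ Fin r ≃ Fin m}

theorem le_of_isHorizontalStrip {ν lam : YoungDiagram} (hs : IsHorizontalStrip ν lam) : lam ≤ ν := by
  rw [← YoungDiagram.cells_subset_iff]
  rintro ⟨i, j⟩ h
  have h1 : j < lam.rowLen i := YoungDiagram.mem_iff_lt_rowLen.1 h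
  exact YoungDiagram.mem_iff_lt_rowLen.2 (h1.trans_le (hs i).1)

theorem eq_one_of_block_mul_mem (hs : IsHorizontalStrip ν.1 lam.1)
    (hl : ∀ a, (tableau ν.1 ν.2 (e (Sum.inl a))).1 = (tableau lam.1 lam.2 a).1)
    (hr : ∀ b, (tableau ν.1 ν.2 (e (Sum.inr b))).1 ∉ lam.1.cells)
    {p : Equiv.Perm (Fin k)} (hp : p ∈ rowStabilizer lam.1 lam.2) (u : Equiv.Perm (Fin r))
    {q : Equiv.Perm (Fin m)} (hq : q ∈ colStabilizer ν.1 ν.2)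
    (hw : blockHom e (p, u) * q ∈ rowStabilizer ν.1 ν.2) : q = 1 := by
  rw [mem_rowStabilizer] at hp hw
  rw [mem_colStabilizer] at hq
  have h1 : ∀ x a, q x = e (Sum.inl a) → q x = x := fun x a hx => by
    have h2 := hw x
    rw [Equiv.Perm.mul_apply, hx, blockHom_inl, hl, hp, ← hl, ← hx] at h2
    exact (tableau ν.1 ν.2).injective (Subtype.ext (Prod.ext h2 (hq x)))
  have h2 : ∀ a, q (e (Sum.inl a)) = e (Sum.inl a) := fun a => by
    have h : q (q⁻¹ (e (Sum.inl a))) = e (Sum.inl a) := q.apply_symm_apply _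
    have h' := h1 _ a h
    rw [h] at h'
    conv_lhs => rw [h', h]
  have hcol : ∀ c c' : ℕ × ℕ, c' ∈ ν.1.cells → c ∉ lam.1.cells → c.2 = c'.2 →
      c.1 < c'.1 → False := by
    rintro ⟨i, j⟩ ⟨i', j'⟩ hc' hc hj hi
    simp only at hj hi
    subst hj
    have h3 : j < ν.1.rowLen i' := YoungDiagram.mem_iff_lt_rowLen.1 hc'
    have h4 := ν.1.rowLen_anti (i + 1) i' hi
    have h5 := (hs i).2
    exact hc (YoungDiagram.mem_iff_lt_rowLen.2 (by omega))
  ext1 x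
  obtain ⟨a | b, rfl⟩ := e.surjective x
  · exact h2 a
  · obtain ⟨a' | b', hx⟩ := e.surjective (q (e (Sum.inr b)))
    · exact h1 _ a' hx.symm
    · have hc := hq (e (Sum.inr b))
      refine (tableau ν.1 ν.2).injective (Subtype.ext (Prod.ext ?_ hc))
      have hn : (tableau ν.1 ν.2 (q (e (Sum.inr b)))).1 ∉ lam.1.cells := hx ▸ hr b'
      rcases lt_trichotomy (tableau ν.1 ν.2 (q (e (Sum.inr b)))).1.1
        (tableau ν.1 ν.2 (e (Sum.inr b))).1.1 with h | h | h
      · exact (hcol _ _ (tableau ν.1 ν.2 (e (Sum.inr b))).2 hn hc h).elim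
      · exact h
      · exact (hcol _ _ (tableau ν.1 ν.2 _).2 (hr b) hc.symm h).elim

theorem coeff_colSum_mul_rowSum (hs : IsHorizontalStrip ν.1 lam.1)
    (hl : ∀ a, (tableau ν.1 ν.2 (e (Sum.inl a))).1 = (tableau lam.1 lam.2 a).1)
    (hr : ∀ b, (tableau ν.1 ν.2 (e (Sum.inr b))).1 ∉ lam.1.cells)
    {p : Equiv.Perm (Fin k)} (hp : p ∈ rowStabilizer lam.1 lam.2) (u : Equiv.Perm (Fin r)) :
    (colSum ν.1 ν.2 * rowSum ν.1 ν.2).coeff (blockHom e (p, u))⁻¹ =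
      if blockHom e (p, u) ∈ rowStabilizer ν.1 ν.2 then 1 else 0 := by
  rw [coeff_mul_eq_sum, Finset.sum_eq_single 1]
  · simp [coeff_colSum, coeff_rowSum, one_mem_colStabilizer, ratSign, inv_mem_rowStabilizer]
  · intro q _ hq
    rw [coeff_colSum, coeff_rowSum]
    by_cases h1 : q ∈ colStabilizer ν.1 ν.2
    · rw [if_neg (c := q⁻¹ * _ ∈ _), mul_zero]
      rw [← mul_inv_rev, inv_mem_rowStabilizer]
      exact fun h2 => hq (eq_one_of_block_mul_mem hs hl hr hp u h1 h2)
    · rw [if_neg h1, zero_mul]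
  · simp

theorem blockLeft_colSum_mul_colSum
    (hl : ∀ a, (tableau ν.1 ν.2 (e (Sum.inl a))).1 = (tableau lam.1 lam.2 a).1) :
    blockLeft e (colSum lam.1 lam.2) * colSum ν.1 ν.2 =
      ((colStabilizer lam.1 lam.2).card : ℚ) • colSum ν.1 ν.2 := by
  rw [colSum, map_sum, Finset.sum_mul, Finset.cast_card, Finset.sum_smul]
  refine Finset.sum_congr rfl fun q hq => ?_
  have hq' : blockHom e (q, 1) ∈ colStabilizer ν.1 ν.2 := by
    rw [mem_colStabilizer] at hq ⊢
    intro x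
    obtain ⟨a | b, rfl⟩ := e.surjective x
    · rw [blockHom_inl, hl, hl, hq]
    · rw [blockHom_inr]
      rfl
  have hsign : ratSign (blockHom e (q, 1)) = ratSign q := by
    simp [ratSign, blockHom, Equiv.permCongrHom]
  have h1 : MonoidAlgebra.single (blockHom e (q, 1)) (ratSign q) =
      ratSign q • MonoidAlgebra.single (blockHom e (q, 1)) (1 : ℚ) := by simp
  rw [blockLeft_single, h1, smul_mul_assoc, single_mul_colSum hq', hsign, smul_smul,
    ratSign_mul_self]

theorem block_mul_colSum_mul_rowSum_ne_zero (hs : IsHorizontalStrip ν.1 lam.1)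
    (hl : ∀ a, (tableau ν.1 ν.2 (e (Sum.inl a))).1 = (tableau lam.1 lam.2 a).1)
    (hr : ∀ b, (tableau ν.1 ν.2 (e (Sum.inr b))).1 ∉ lam.1.cells) :
    blockLeft e (rowSum lam.1 lam.2) * blockRight e (averageElt r) *
      (colSum ν.1 ν.2 * rowSum ν.1 ν.2) ≠ 0 := by
  intro h0
  have h1 := congrArg (fun y => y.coeff 1) h0
  simp only [MonoidAlgebra.coeff_zero, Finsupp.coe_zero, Pi.zero_apply] at h1
  rw [rowSum, averageElt, map_sum, map_sum, Finset.sum_mul_sum, Finset.sum_mul,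
    MonoidAlgebra.coeff_sum, Finsupp.finsetSum_apply] at h1
  have hterm : ∀ p ∈ rowStabilizer lam.1 lam.2, ∀ u : Equiv.Perm (Fin r),
      ((blockLeft e (MonoidAlgebra.single p 1) *
        blockRight e (MonoidAlgebra.single u (r.factorial : ℚ)⁻¹)) *
        (colSum ν.1 ν.2 * rowSum ν.1 ν.2)).coeff 1 =
      (r.factorial : ℚ)⁻¹ * if blockHom e (p, u) ∈ rowStabilizer ν.1 ν.2 then 1 else 0 := by
    intro p hp u
    rw [blockLeft_mul_blockRight_single, MonoidAlgebra.coeff_single_mul_apply, mul_one,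
      coeff_colSum_mul_rowSum hs hl hr hp, one_mul]
  have hnn : ∀ p ∈ rowStabilizer lam.1 lam.2, 0 ≤ ((∑ u : Equiv.Perm (Fin r),
      blockLeft e (MonoidAlgebra.single p 1) *
        blockRight e (MonoidAlgebra.single u (r.factorial : ℚ)⁻¹)) *
        (colSum ν.1 ν.2 * rowSum ν.1 ν.2)).coeff 1 := by
    intro p hp
    rw [Finset.sum_mul, MonoidAlgebra.coeff_sum, Finsupp.finsetSum_apply]
    refine Finset.sum_nonneg fun u _ => ?_
    rw [hterm p hp]
    split_ifs <;> positivity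
  rw [Finset.sum_eq_zero_iff_of_nonneg hnn] at h1
  have h2 := h1 1 (one_mem_rowStabilizer _ _)
  rw [Finset.sum_mul, MonoidAlgebra.coeff_sum, Finsupp.finsetSum_apply,
    Finset.sum_eq_zero_iff_of_nonneg] at h2
  · have h3 := h2 1 (Finset.mem_univ _)
    rw [hterm 1 (one_mem_rowStabilizer _ _), if_pos, mul_one] at h3
    · exact inv_ne_zero (Nat.cast_ne_zero.2 r.factorial_ne_zero) h3
    · have : ((1 : Equiv.Perm (Fin k)), (1 : Equiv.Perm (Fin r))) = 1 := rfl
      rw [this, map_one]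
      exact one_mem_rowStabilizer _ _
  · intro u _
    rw [hterm 1 (one_mem_rowStabilizer _ _)]
    split_ifs <;> positivity

theorem one_le_pairing_schur (hm : k + r = m) (hs : IsHorizontalStrip ν.1 lam.1) :
    1 ≤ pairing (schur ν) (complete r * schur lam) := by
  obtain ⟨e, hl, hr⟩ := exists_block_decomposition lam ν hm (le_of_isHorizontalStrip hs)
  set x := blockLeft e (youngIdempotent lam.1 lam.2) * blockRight e (averageElt r) with hx
  have hxx : x * x = x := block_idempotent e (youngIdempotent_mul_self _ _)
  have h1 : pairing (schur ν) (complete r * schur lam) =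
      Module.finrank ℚ (LinearMap.range (Algebra.lsmul ℚ ℚ (simpleModule ν.1 ν.2) x)) := by
    rw [← traceOn_idempotent hxx, traceOn_simpleModule, hx, cyclePoly_block, mul_comm]
    rfl
  rw [h1, Nat.one_le_cast, Nat.one_le_iff_ne_zero]
  intro h0
  rw [Submodule.finrank_eq_zero, LinearMap.range_eq_bot] at h0
  have h2 : x * (colSum ν.1 ν.2 * youngSymmetrizer ν.1 ν.2) = 0 := by
    have := LinearMap.congr_fun h0 ⟨colSum ν.1 ν.2 * youngSymmetrizer ν.1 ν.2,
      Submodule.mem_span_singleton.2 ⟨_, rfl⟩⟩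
    exact congrArg Subtype.val this
  have h3 : (colSum ν.1 ν.2 * rowSum ν.1 ν.2) * (colSum ν.1 ν.2 * rowSum ν.1 ν.2) =
      youngScalar ν.1 ν.2 • (colSum ν.1 ν.2 * rowSum ν.1 ν.2) := by
    have := congrArg inversion (youngSymmetrizer_mul_self ν.1 ν.2)
    rwa [map_smul, inversion_mul, youngSymmetrizer_eq, inversion_mul, inversion_colSum,
      inversion_rowSum] at this
  have h4 : x * (colSum ν.1 ν.2 * rowSum ν.1 ν.2) = 0 := by
    have h5 : x * ((colSum ν.1 ν.2 * rowSum ν.1 ν.2) * (colSum ν.1 ν.2 * rowSum ν.1 ν.2)) = 0 := by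
      have : x * ((colSum ν.1 ν.2 * rowSum ν.1 ν.2) * (colSum ν.1 ν.2 * rowSum ν.1 ν.2)) =
          x * (colSum ν.1 ν.2 * youngSymmetrizer ν.1 ν.2) * rowSum ν.1 ν.2 := by
        simp only [youngSymmetrizer_eq, mul_assoc]
      rw [this, h2, zero_mul]
    rw [h3, mul_smul_comm] at h5
    exact (smul_eq_zero.1 h5).resolve_left (youngScalar_ne_zero _ _)
  have h6 : blockLeft e (youngSymmetrizer lam.1 lam.2) * blockRight e (averageElt r) *
      (colSum ν.1 ν.2 * rowSum ν.1 ν.2) = 0 := by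
    rw [youngSymmetrizer_eq_smul, map_smul, smul_mul_assoc, smul_mul_assoc, ← hx, h4, smul_zero]
  rw [youngSymmetrizer_eq, map_mul, mul_assoc (blockLeft e _), ← blockLeft_blockRight_comm]
    at h6
  have h7 : blockLeft e (rowSum lam.1 lam.2) * (blockRight e (averageElt r) *
      blockLeft e (colSum lam.1 lam.2)) * (colSum ν.1 ν.2 * rowSum ν.1 ν.2) =
      blockLeft e (rowSum lam.1 lam.2) * blockRight e (averageElt r) *
        (blockLeft e (colSum lam.1 lam.2) * colSum ν.1 ν.2 * rowSum ν.1 ν.2) := by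
    simp only [mul_assoc]
  rw [h7, blockLeft_colSum_mul_colSum hl, smul_mul_assoc, mul_smul_comm, smul_eq_zero] at h6
  refine block_mul_colSum_mul_rowSum_ne_zero hs hl hr (h6.resolve_left ?_)
  exact Nat.cast_ne_zero.2 (Finset.card_ne_zero_of_mem (one_mem_colStabilizer _ _))

theorem mem_homogeneousPart_iff {F : MvPolynomial ℕ+ ℚ} :
    F ∈ homogeneousPart m ↔ ∀ σ, coeff σ F ≠ 0 → cycleWeight σ = m := by
  classical
  constructor
  · intro hF
    induction hF using Submodule.span_induction with
    | mem x hx =>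
      obtain ⟨τ, rfl⟩ := hx
      intro σ hσ
      rw [coeff_monomial] at hσ
      obtain rfl : τ.1 = σ := by
        by_contra h
        exact hσ (if_neg h)
      exact τ.2
    | zero => intro σ hσ; simp at hσ
    | add x y _ _ hx hy =>
      intro σ hσ
      by_contra h
      rw [coeff_add, not_not.1 (mt (hx σ) h), not_not.1 (mt (hy σ) h), add_zero] at hσ
      exact hσ rfl
    | smul a x _ hx =>
      intro σ hσ
      rw [coeff_smul, smul_eq_mul] at hσ
      exact hx σ (right_ne_zero_of_mul hσ)
  · intro h
    rw [F.as_sum]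
    exact Submodule.sum_mem _ fun σ hσ =>
      monomial_mem_homogeneousPart (h σ (mem_support_iff.1 hσ)) _

theorem pairing_eq_zero_of_ne {a b : ℕ} (hab : a ≠ b) {F G : MvPolynomial ℕ+ ℚ}
    (hF : F ∈ homogeneousPart a) (hG : G ∈ homogeneousPart b) : pairing F G = 0 := by
  rw [F.as_sum, map_sum, LinearMap.sum_apply]
  refine Finset.sum_eq_zero fun σ hσ => ?_
  rw [pairing_monomial]
  have h1 := mem_homogeneousPart_iff.1 hF σ (mem_support_iff.1 hσ)
  have h2 : coeff σ G = 0 := by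
    by_contra h
    exact hab (h1.symm.trans (mem_homogeneousPart_iff.1 hG σ h))
  rw [h2, mul_zero, mul_zero]

theorem cycleWeight_add_of_coeff_skew_ne_zero {F : MvPolynomial ℕ+ ℚ}
    (hF : F ∈ homogeneousPart k) {j : ℕ} {σ : ℕ+ →₀ ℕ} (hσ : coeff σ (skew j F) ≠ 0) :
    j + cycleWeight σ = k := by
  by_contra h
  have h1 := pairing_eq_zero_of_ne h (mul_mem_homogeneousPart (complete_mem j)
    (monomial_mem_homogeneousPart (σ := σ) rfl 1)) hF
  rw [pairing_complete_mul, pairing_monomial, one_mul, mul_eq_zero] at h1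
  exact h1.elim (centralizerOrder_ne_zero σ) hσ

theorem skew_mem {F : MvPolynomial ℕ+ ℚ} (hF : F ∈ homogeneousPart k) (j : ℕ) :
    skew j F ∈ homogeneousPart (k - j) :=
  mem_homogeneousPart_iff.2 fun σ hσ => by
    have := cycleWeight_add_of_coeff_skew_ne_zero hF hσ
    omega

theorem skew_eq_zero {F : MvPolynomial ℕ+ ℚ} (hF : F ∈ homogeneousPart k) {j : ℕ} (hj : k < j) :
    skew j F = 0 := by
  ext σ
  by_contra hσ
  have := cycleWeight_add_of_coeff_skew_ne_zero hF hσ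
  omega

theorem eq_of_isHorizontalStrip {ν lam : YoungDiagram} (hs : IsHorizontalStrip ν lam)
    (hc : ν.card ≤ lam.card) : ν = lam := by
  refine (YoungDiagram.ext ?_).symm
  exact Finset.eq_of_subset_of_card_le (YoungDiagram.cells_subset_iff.2
    (le_of_isHorizontalStrip hs)) hc

theorem complete_zero : complete 0 = 1 := by
  have h : averageElt 0 = MonoidAlgebra.single 1 1 := by
    refine MonoidAlgebra.coeff_injective (Finsupp.ext fun g => ?_)
    rw [coeff_averageElt, Subsingleton.elim g 1]
    simp
  rw [complete, h, cyclePoly_single]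
  have : cycleExponent (1 : Equiv.Perm (Fin 0)) = 0 := by
    ext i
    have h1 := cycleWeight_cycleExponent (1 : Equiv.Perm (Fin 0))
    by_contra h2
    have := le_cycleWeight (Finsupp.mem_support_iff.2 h2)
    have := i.pos
    omega
  rw [this]
  rfl

/-- The row lengths of the diagram obtained from `lam` by adding to row `i + 1` as many cells as
row `i` loses in `κ`, and `c` cells to the first row. -/
def slideRowLen (lam κ : YoungDiagram) (c : ℕ) : ℕ → ℕ
  | 0 => lam.rowLen 0 + c
  | i + 1 => lam.rowLen (i + 1) + (lam.rowLen i - κ.rowLen i)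

theorem slideRowLen_antitone {lam κ : YoungDiagram} (hs : IsHorizontalStrip lam κ) (c : ℕ) :
    Antitone (slideRowLen lam κ c) := by
  refine antitone_nat_of_succ_le fun i => ?_
  have h1 := hs i
  cases i with
  | zero =>
    simp only [slideRowLen, zero_add] at *
    omega
  | succ i =>
    simp only [slideRowLen] at *
    omega

theorem slideRowLen_eq_zero {lam κ : YoungDiagram} (c : ℕ) :
    slideRowLen lam κ c (lam.card + 1) = 0 := by
  simp [slideRowLen, rowLen_card_eq_zero lam le_rfl, rowLen_card_eq_zero lam (Nat.le_succ _)]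

theorem sum_slideRowLen {lam κ : YoungDiagram} (hs : IsHorizontalStrip lam κ) (c : ℕ) :
    ∑ i ∈ Finset.range (lam.card + 1), slideRowLen lam κ c i = lam.card + c +
      (lam.card - κ.card) := by
  rw [Finset.sum_range_succ']
  simp only [slideRowLen, Finset.sum_add_distrib]
  have h1 := card_eq_sum_rowLen lam (rowLen_card_eq_zero lam (Nat.le_succ _))
  rw [Finset.sum_range_succ'] at h1
  have h2 := card_eq_sum_rowLen lam (rowLen_card_eq_zero lam le_rfl)
  have hle : κ.card ≤ lam.card :=
    Finset.card_le_card (YoungDiagram.cells_subset_iff.2 (le_of_isHorizontalStrip hs))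
  have h3 := card_eq_sum_rowLen κ (rowLen_card_eq_zero κ hle)
  have h4 : ∑ i ∈ Finset.range lam.card, (lam.rowLen i - κ.rowLen i) +
      ∑ i ∈ Finset.range lam.card, κ.rowLen i = ∑ i ∈ Finset.range lam.card, lam.rowLen i := by
    rw [← Finset.sum_add_distrib]
    exact Finset.sum_congr rfl fun i _ => Nat.sub_add_cancel (hs i).1
  omega

theorem exists_slide (hm : k + r = m) (lam : Diagram k) {j : ℕ} (hj : j ≤ r) (hjk : j ≤ k)
    {κ : Diagram (k - j)} (hs : IsHorizontalStrip lam.1 κ.1) :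
    ∃ ν : Diagram m, IsHorizontalStrip ν.1 lam.1 ∧
      ∀ i, ν.1.rowLen i = slideRowLen lam.1 κ.1 (r - j) i := by
  have h0 := slideRowLen_eq_zero (lam := lam.1) (κ := κ.1) (r - j)
  have hrow := rowLen_diagramOfRowLen (slideRowLen_antitone hs (r - j)) h0
  refine ⟨⟨diagramOfRowLen _ (slideRowLen_antitone hs (r - j)) _, ?_⟩, fun i => ?_, hrow⟩
  · rw [card_eq_sum_rowLen _ ((hrow _).trans h0)]
    simp only [hrow]
    rw [sum_slideRowLen hs, lam.2, κ.2]
    omega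
  · simp only [hrow]
    have h1 := hs i
    cases i with
    | zero =>
      simp only [slideRowLen, zero_add] at *
      omega
    | succ i =>
      have h2 := hs i
      simp only [slideRowLen] at *
      omega

open Classical in
theorem sum_card_le_card (hm : k + r = m) (lam : Diagram k) :
    ∑ j ∈ Finset.range (r + 1), (Finset.univ.filter fun κ : Diagram (k - j) =>
        IsHorizontalStrip lam.1 κ.1 ∧ j ≤ k).card ≤
      (Finset.univ.filter fun ν : Diagram m => IsHorizontalStrip ν.1 lam.1).card := by
  rw [← Finset.card_sigma]
  have hex : ∀ x : (Σ j, Diagram (k - j)), ∃ ν : Diagram m,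
      (x.1 ≤ r ∧ x.1 ≤ k ∧ IsHorizontalStrip lam.1 x.2.1) → IsHorizontalStrip ν.1 lam.1 ∧
      ∀ i, ν.1.rowLen i = slideRowLen lam.1 x.2.1 (r - x.1) i := by
    rintro ⟨j, κ⟩
    by_cases h : j ≤ r ∧ j ≤ k ∧ IsHorizontalStrip lam.1 κ.1
    · obtain ⟨ν, hν⟩ := exists_slide hm lam h.1 h.2.1 h.2.2
      exact ⟨ν, fun _ => hν⟩
    · obtain ⟨ν, -⟩ := exists_slide hm lam (Nat.zero_le r) (Nat.zero_le k) (κ := lam)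
        fun i => ⟨le_rfl, lam.1.rowLen_anti _ _ (Nat.le_succ i)⟩
      exact ⟨ν, fun h' => absurd h' h⟩
  choose f hf using hex
  refine Finset.card_le_card_of_injOn f ?_ ?_
  · rintro ⟨j, κ⟩ hx
    simp only [Finset.coe_sigma, Set.mem_sigma_iff, Finset.mem_coe, Finset.mem_range,
      Finset.mem_filter, Finset.mem_univ, true_and] at hx ⊢
    exact (hf ⟨j, κ⟩ ⟨by simp only; omega, hx.2.2, hx.2.1⟩).1
  · rintro ⟨j, κ⟩ hx ⟨j', κ'⟩ hx' hxx'
    simp only [Finset.coe_sigma, Set.mem_sigma_iff, Finset.mem_coe, Finset.mem_range,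
      Finset.mem_filter, Finset.mem_univ, true_and] at hx hx'
    have h1 := (hf ⟨j, κ⟩ ⟨by simp only; omega, hx.2.2, hx.2.1⟩).2
    have h2 := (hf ⟨j', κ'⟩ ⟨by simp only; omega, hx'.2.2, hx'.2.1⟩).2
    rw [hxx'] at h1
    have h3 : κ.1 = κ'.1 := eq_of_rowLen_eq fun i => by
      have h4 := (h1 (i + 1)).symm.trans (h2 (i + 1))
      have h5 := (hx.2.1 i).1
      have h6 := (hx'.2.1 i).1
      simp only [slideRowLen] at h4
      omega
    obtain ⟨κ, hκ⟩ := κ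
    obtain ⟨κ', hκ'⟩ := κ'
    simp only at h3
    subst h3
    obtain rfl : j = j' := by
      have := hx.2.2
      have := hx'.2.2
      omega
    rfl

open Classical in
/-- **Pieri's rule**. -/
theorem pairing_schur_complete_mul (hm : k + r = m) (lam : Diagram k) (ν : Diagram m) :
    pairing (schur ν) (complete r * schur lam) =
      if IsHorizontalStrip ν.1 lam.1 then 1 else 0 := by
  induction m using Nat.strong_induction_on generalizing k r with
  | _ m ih =>
  rcases Nat.eq_zero_or_pos r with rfl | hr
  · obtain rfl : k = m := hm
    rw [complete_zero, one_mul, pairing_schur]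
    refine if_congr ⟨?_, fun hs => Subtype.ext (eq_of_isHorizontalStrip hs
      (ν.2.trans lam.2.symm).le)⟩ rfl rfl
    rintro rfl i
    exact ⟨le_rfl, ν.1.rowLen_anti _ _ (Nat.le_succ i)⟩
  have hskew : ∀ j, pairing (skew j (schur lam)) (skew j (schur lam)) =
      ((Finset.univ.filter fun κ : Diagram (k - j) =>
        IsHorizontalStrip lam.1 κ.1 ∧ j ≤ k).card : ℚ) := by
    intro j
    by_cases hj : j ≤ k
    · rw [pairing_self_eq_sum (skew_mem (schur_mem lam) j), Finset.card_filter, Nat.cast_sum]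
      refine Finset.sum_congr rfl fun κ _ => ?_
      rw [← pairing_complete_mul, pairing_comm, ih k (by omega) (Nat.sub_add_cancel hj) κ lam]
      by_cases h : IsHorizontalStrip lam.1 κ.1 <;> simp [h, hj]
    · rw [skew_eq_zero (schur_mem lam) (not_le.1 hj)]
      simp [hj]
  have hmem : complete r * schur lam ∈ homogeneousPart m := by
    rw [← hm, mul_comm]
    exact mul_mem_homogeneousPart (schur_mem lam) (complete_mem r)
  have hnorm : ∑ μ : Diagram m, pairing (schur μ) (complete r * schur lam) ^ 2 ≤
      ∑ μ : Diagram m, if IsHorizontalStrip μ.1 lam.1 then 1 else 0 := by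
    rw [← pairing_self_eq_sum hmem, pairing_complete_mul_self]
    simp only [hskew]
    have := sum_card_le_card hm lam
    rw [Finset.card_filter _ (Finset.univ : Finset (Diagram m))] at this
    exact_mod_cast this
  have hle : ∀ μ ∈ (Finset.univ : Finset (Diagram m)),
      (if IsHorizontalStrip μ.1 lam.1 then 1 else 0) ≤
        pairing (schur μ) (complete r * schur lam) ^ 2 := fun μ _ => by
    split_ifs with h
    · exact one_le_pow₀ (one_le_pairing_schur hm h)
    · positivity
  have heq := (Finset.sum_eq_sum_iff_of_le hle).1 (le_antisymm (Finset.sum_le_sum hle) hnorm) ν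
    (Finset.mem_univ _)
  split_ifs at heq ⊢ with h
  · have h1 := one_le_pairing_schur hm h
    nlinarith
  · exact pow_eq_zero_iff two_ne_zero |>.1 heq.symm

end Pieri

end SymmetricRep

namespace SymmetricRep

open MvPolynomial

/-! ### Character polynomials -/

section CharPoly

/-- The polynomial `∏ i ^ ρ_i X_i (X_i - 1) ⋯ (X_i - ρ_i + 1)`. -/
noncomputable def fallingMonomial (ρ : ℕ+ →₀ ℕ) : MvPolynomial ℕ+ ℚ :=
  ρ.prod fun i n => ∏ j ∈ Finset.range n, (C ((i : ℕ) : ℚ) * (X i - C (j : ℚ)))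

/-- The linear map `p^ρ ↦ ∏ i ^ ρ_i X_i (X_i - 1) ⋯ (X_i - ρ_i + 1)`. -/
noncomputable def charPoly : MvPolynomial ℕ+ ℚ →ₗ[ℚ] MvPolynomial ℕ+ ℚ :=
  (basisMonomials ℕ+ ℚ).constr ℚ fallingMonomial

theorem charPoly_monomial (ρ : ℕ+ →₀ ℕ) (a : ℚ) :
    charPoly (monomial ρ a) = a • fallingMonomial ρ := by
  have h1 : monomial ρ a = a • basisMonomials ℕ+ ℚ ρ := by
    rw [coe_basisMonomials, smul_monomial, smul_eq_mul, mul_one]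
  rw [h1, map_smul, charPoly, Module.Basis.constr_basis]

theorem fallingMonomial_add_single (ρ : ℕ+ →₀ ℕ) (i : ℕ+) :
    fallingMonomial (ρ + Finsupp.single i 1) =
      C ((i : ℕ) : ℚ) * (X i - C (ρ i : ℚ)) * fallingMonomial ρ := by
  have key : ∀ τ : ℕ+ →₀ ℕ, fallingMonomial τ =
      (∏ j ∈ Finset.range (τ i), (C ((i : ℕ) : ℚ) * (X i - C (j : ℚ)))) *
        fallingMonomial (τ.erase i) := fun τ =>
    (Finsupp.mul_prod_erase' τ i
      (fun i n => ∏ j ∈ Finset.range n, (C ((i : ℕ) : ℚ) * (X i - C (j : ℚ)))) (by simp)).symm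
  rw [key, key ρ]
  have : (ρ + Finsupp.single i 1).erase i = ρ.erase i := by
    rw [Finsupp.erase_add, Finsupp.erase_single, add_zero]
  rw [this, Finsupp.add_apply, Finsupp.single_eq_same, Finset.prod_range_succ]
  ring

theorem prod_range_sub_eq_descFactorial (x n : ℕ) :
    ∏ j ∈ Finset.range n, ((x : ℚ) - j) = (x.descFactorial n : ℚ) := by
  induction n with
  | zero => simp
  | succ n ih =>
    rw [Finset.prod_range_succ, ih, Nat.descFactorial_succ, Nat.cast_mul]
    rcases le_or_gt n x with h | h
    · rw [Nat.cast_sub h, mul_comm]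
    · simp [Nat.descFactorial_eq_zero_iff_lt.2 h]

theorem eval_fallingMonomial (ρ : ℕ+ →₀ ℕ) (x : ℕ+ → ℕ) :
    eval (fun i => (x i : ℚ)) (fallingMonomial ρ) =
      ρ.prod fun i n => ((i : ℕ) : ℚ) ^ n * ((x i).descFactorial n : ℚ) := by
  rw [fallingMonomial, Finsupp.prod, Finsupp.prod, map_prod]
  refine Finset.prod_congr rfl fun i _ => ?_
  rw [map_prod]
  simp only [map_mul, map_sub, eval_C, eval_X, Finset.prod_mul_distrib, Finset.prod_const,
    Finset.card_range]
  congr 1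
  exact prod_range_sub_eq_descFactorial _ _

theorem centralizerOrder_eq_mul {ρ σ : ℕ+ →₀ ℕ} (h : ρ ≤ σ) :
    centralizerOrder σ = centralizerOrder (σ - ρ) *
      ρ.prod fun i n => ((i : ℕ) : ℚ) ^ n * ((σ i).descFactorial n : ℚ) := by
  have h1 : ρ.support ⊆ σ.support := Finsupp.support_mono h
  have h2 : (σ - ρ).support ⊆ σ.support := Finsupp.support_mono tsub_le_self
  rw [centralizerOrder, centralizerOrder, Finsupp.prod_of_support_subset _ h1 _ (by simp),
    Finsupp.prod_of_support_subset _ h2 _ (by simp), Finsupp.prod, ← Finset.prod_mul_distrib]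
  refine Finset.prod_congr rfl fun i _ => ?_
  have h3 : ρ i ≤ σ i := h i
  rw [← Nat.factorial_mul_descFactorial h3, Finsupp.tsub_apply]
  conv_lhs => rw [← Nat.sub_add_cancel h3, pow_add, Nat.sub_add_cancel h3]
  push_cast
  ring

theorem pairing_complete_mul_monomial {k r : ℕ} {F : MvPolynomial ℕ+ ℚ}
    (hF : F ∈ homogeneousPart k) {σ : ℕ+ →₀ ℕ} (hσ : cycleWeight σ = k + r) :
    pairing (complete r * F) (monomial σ 1) = eval (fun i => (σ i : ℚ)) (charPoly F) := by
  classical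
  have h0 : ∀ ρ : ℕ+ →₀ ℕ, cycleWeight ρ = k → ∀ a : ℚ,
      pairing (complete r * monomial ρ a) (monomial σ 1) =
        eval (fun i => (σ i : ℚ)) (charPoly (monomial ρ a)) := by
    intro ρ hρ a
    rw [pairing_comm, pairing_monomial, coeff_mul_monomial', charPoly_monomial, smul_eval,
      eval_fallingMonomial, one_mul]
    split_ifs with h
    · have h1 : cycleWeight (σ - ρ) = r := by
        have := congrArg cycleWeight (tsub_add_cancel_of_le h)
        rw [map_add] at this
        omega
      have h2 := centralizerOrder_ne_zero (σ - ρ)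
      rw [coeff_complete, if_pos h1, centralizerOrder_eq_mul h]
      field_simp
    · rw [mul_zero]
      rw [Finsupp.le_def] at h
      push Not at h
      obtain ⟨i, hi⟩ := h
      rw [Finsupp.prod, Finset.prod_eq_zero (i := i), mul_zero]
      · rw [Finsupp.mem_support_iff]
        omega
      · rw [Nat.descFactorial_eq_zero_iff_lt.2 hi]
        simp
  rw [F.as_sum, Finset.mul_sum, map_sum, map_sum, map_sum, LinearMap.sum_apply]
  exact Finset.sum_congr rfl fun ρ hρ =>
    h0 ρ (mem_homogeneousPart_iff.1 hF ρ (mem_support_iff.1 hρ)) _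

/-- A polynomial in the cycle numbers is determined by its values on large permutations. -/
theorem eq_of_eval_numCycles_eq {P Q : MvPolynomial ℕ+ ℚ} (M : ℕ)
    (h : ∀ m, M ≤ m → ∀ g : Equiv.Perm (Fin m),
      eval (fun i => (numCycles g i : ℚ)) P = eval (fun i => (numCycles g i : ℚ)) Q) : P = Q := by
  classical
  refine funext_set (fun _ => Set.range fun n : ℕ => (n : ℚ))
    (fun _ => Set.infinite_range_of_injective Nat.cast_injective) fun x hx => ?_
  choose y hy using fun i => hx i (Set.mem_univ i)
  obtain rfl : (fun i => (y i : ℚ)) = x := funext hy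
  obtain ⟨i₀, hi₀⟩ := Infinite.exists_notMem_finset (P.vars ∪ Q.vars)
  set σ : ℕ+ →₀ ℕ := Finsupp.onFinset (insert i₀ (P.vars ∪ Q.vars))
    (fun i => if i = i₀ then M else if i ∈ P.vars ∪ Q.vars then y i else 0) (by
      intro i hi
      by_contra hn
      rw [Finset.mem_insert, not_or] at hn
      rw [if_neg hn.1, if_neg hn.2] at hi
      exact hi rfl) with hσ
  have hσy : ∀ i ∈ P.vars ∪ Q.vars, σ i = y i := fun i hi => by
    rw [hσ, Finsupp.onFinset_apply, if_neg (by rintro rfl; exact hi₀ hi), if_pos hi]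
  have hσM : M ≤ cycleWeight σ := by
    have h1 : σ i₀ = M := by rw [hσ, Finsupp.onFinset_apply, if_pos rfl]
    rcases Nat.eq_zero_or_pos M with h0 | h0
    · omega
    · have h2 : i₀ ∈ σ.support := Finsupp.mem_support_iff.2 (by omega)
      rw [cycleWeight, Finsupp.weight_apply, Finsupp.sum]
      refine le_trans ?_ (Finset.single_le_sum (f := fun i : ℕ+ => σ i • (i : ℕ))
        (fun _ _ => Nat.zero_le _) h2)
      rw [h1]
      exact Nat.le_mul_of_pos_right _ i₀.pos
  obtain ⟨g, hg⟩ := exists_cycleExponent_eq (σ := σ) rfl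
  have h3 := h _ hσM g
  have hgσ : ∀ i, numCycles g i = σ i := fun i => by rw [← cycleExponent_apply, hg]
  simp only [hgσ] at h3
  have h4 : eval (fun i => (y i : ℚ)) P = eval (fun i => (σ i : ℚ)) P :=
    eval₂Hom_congr' rfl (fun i hi _ => by rw [hσy i (Finset.mem_union_left _ hi)]) rfl
  have h5 : eval (fun i => (y i : ℚ)) Q = eval (fun i => (σ i : ℚ)) Q :=
    eval₂Hom_congr' rfl (fun i hi _ => by rw [hσy i (Finset.mem_union_right _ hi)]) rfl
  rw [h4, h5, h3]

end CharPoly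

section Padded

theorem rowLen_padded_zero (κ : YoungDiagram) (m : ℕ) (h : κ.card + κ.rowLen 0 ≤ m) :
    (padded κ m h).rowLen 0 = m - κ.card := by
  have key : ∀ j, j < (padded κ m h).rowLen 0 ↔ j < m - κ.card := fun j => by
    rw [← YoungDiagram.mem_iff_lt_rowLen, ← YoungDiagram.mem_cells, padded]
    simp
  have h1 := key (m - κ.card)
  have h2 := key ((padded κ m h).rowLen 0)
  omega

theorem rowLen_padded_succ (κ : YoungDiagram) (m : ℕ) (h : κ.card + κ.rowLen 0 ≤ m) (i : ℕ) :
    (padded κ m h).rowLen (i + 1) = κ.rowLen i := by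
  have key : ∀ j, j < (padded κ m h).rowLen (i + 1) ↔ j < κ.rowLen i := fun j => by
    rw [← YoungDiagram.mem_iff_lt_rowLen, ← YoungDiagram.mem_iff_lt_rowLen,
      ← YoungDiagram.mem_cells, padded]
    simp
  have h1 := key (κ.rowLen i)
  have h2 := key ((padded κ m h).rowLen (i + 1))
  omega

/-- The diagram of `κ[m]` as an element of the type of diagrams with `m` cells. -/
def paddedDiagram (κ : YoungDiagram) (m : ℕ) (h : κ.card + κ.rowLen 0 ≤ m) : Diagram m :=
  ⟨padded κ m h, card_padded κ m h⟩

theorem paddedDiagram_injective {κ κ' : YoungDiagram} {m : ℕ} {h : κ.card + κ.rowLen 0 ≤ m}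
    {h' : κ'.card + κ'.rowLen 0 ≤ m} (heq : paddedDiagram κ m h = paddedDiagram κ' m h') :
    κ = κ' :=
  eq_of_rowLen_eq fun i => by
    rw [← rowLen_padded_succ κ m h, ← rowLen_padded_succ κ' m h']
    exact congrArg (fun μ : Diagram m => μ.1.rowLen (i + 1)) heq

theorem card_le_of_isHorizontalStrip {ν lam : YoungDiagram} (hs : IsHorizontalStrip ν lam) :
    lam.card ≤ ν.card :=
  Finset.card_le_card (YoungDiagram.cells_subset_iff.2 (le_of_isHorizontalStrip hs))

theorem exists_eq_paddedDiagram {k m : ℕ} {lam : Diagram k} {ν : Diagram m}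
    (hs : IsHorizontalStrip ν.1 lam.1) :
    ∃ (κ : YoungDiagram) (h : κ.card + κ.rowLen 0 ≤ m), IsHorizontalStrip lam.1 κ ∧
      ν = paddedDiagram κ m h := by
  have hanti : Antitone fun i => ν.1.rowLen (i + 1) := fun a b hab =>
    ν.1.rowLen_anti _ _ (Nat.succ_le_succ hab)
  have h0 : ν.1.rowLen (m + 1) = 0 := rowLen_card_eq_zero ν.1 (by rw [ν.2]; omega)
  have hrow := rowLen_diagramOfRowLen hanti (B := m) h0
  set κ := diagramOfRowLen _ hanti m with hκ
  have h1 := card_eq_sum_rowLen ν.1 h0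
  rw [Finset.sum_range_succ', ν.2] at h1
  have h2 := card_eq_sum_rowLen κ (B := m) (by rw [hrow, h0])
  simp only [hrow] at h2
  have h3 := ν.1.rowLen_anti 0 1 (Nat.zero_le 1)
  have hκ0 := hrow 0
  simp only [zero_add] at hκ0
  have hb : κ.card + κ.rowLen 0 ≤ m := by omega
  refine ⟨κ, hb, fun i => ⟨by rw [hrow]; exact (hs i).2, by rw [hrow]; exact (hs (i + 1)).1⟩,
    Subtype.ext (eq_of_rowLen_eq fun i => ?_)⟩
  cases i with
  | zero =>
    rw [paddedDiagram, rowLen_padded_zero]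
    omega
  | succ i => rw [paddedDiagram, rowLen_padded_succ, hrow]

theorem isHorizontalStrip_padded {lam κ : YoungDiagram} {m : ℕ}
    (hm : lam.card + lam.rowLen 0 ≤ m) (hs : IsHorizontalStrip lam κ)
    (h : κ.card + κ.rowLen 0 ≤ m) : IsHorizontalStrip (padded κ m h) lam := by
  intro i
  rw [rowLen_padded_succ]
  refine ⟨?_, (hs i).1⟩
  cases i with
  | zero =>
    rw [rowLen_padded_zero]
    have := card_le_of_isHorizontalStrip hs
    omega
  | succ i =>
    rw [rowLen_padded_succ]
    exact (hs i).2

theorem add_rowLen_le_of_isHorizontalStrip {lam κ : YoungDiagram} (hs : IsHorizontalStrip lam κ) :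
    κ.card + κ.rowLen 0 ≤ lam.card + lam.rowLen 0 :=
  add_le_add (card_le_of_isHorizontalStrip hs) (hs 0).1

noncomputable instance (k : ℕ) : Fintype {κ : YoungDiagram // κ.card ≤ k} :=
  have := finite_diagrams k
  Fintype.ofFinite _

/-- The character of `V_{κ[m]}`, extended by zero to small `m`. -/
noncomputable def paddedCharacter (κ : YoungDiagram) (m : ℕ) (g : Equiv.Perm (Fin m)) : ℚ :=
  if h : κ.card + κ.rowLen 0 ≤ m then
    traceOn (paddedSimple κ m h) (MonoidAlgebra.single g 1) else 0

theorem paddedCharacter_eq {κ : YoungDiagram} {m : ℕ} (h : κ.card + κ.rowLen 0 ≤ m)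
    (g : Equiv.Perm (Fin m)) : paddedCharacter κ m g =
      pairing (schur (paddedDiagram κ m h)) (monomial (cycleExponent g) 1) := by
  rw [paddedCharacter, dif_pos h, ← traceOn_simpleModule_single]
  rfl

open Classical in
/-- The diagrams `κ` for which `lam / κ` is a horizontal strip. -/
noncomputable def stripsBelow (lam : YoungDiagram) : Finset YoungDiagram :=
  (Finset.univ.filter fun κ : {κ : YoungDiagram // κ.card ≤ lam.card} =>
    IsHorizontalStrip lam κ.1).map (Function.Embedding.subtype _)

theorem mem_stripsBelow {lam κ : YoungDiagram} :
    κ ∈ stripsBelow lam ↔ IsHorizontalStrip lam κ := by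
  classical
  simp only [stripsBelow, Finset.mem_map, Finset.mem_filter, Finset.mem_univ, true_and,
    Function.Embedding.subtype_apply, Subtype.exists, exists_and_right, exists_eq_right]
  exact ⟨fun h => h.2, fun h => ⟨card_le_of_isHorizontalStrip h, h⟩⟩

theorem self_mem_stripsBelow (lam : YoungDiagram) : lam ∈ stripsBelow lam :=
  mem_stripsBelow.2 fun i => ⟨le_rfl, lam.rowLen_anti _ _ (Nat.le_succ i)⟩

/-- The sum of the characters of the `V_{κ[m]}` over the horizontal strips `lam / κ` is given by a
polynomial. -/
theorem sum_paddedCharacter {k : ℕ} (lam : Diagram k) {m : ℕ}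
    (hm : lam.1.card + lam.1.rowLen 0 ≤ m) (g : Equiv.Perm (Fin m)) :
    ∑ κ ∈ stripsBelow lam.1, paddedCharacter κ m g =
      eval (fun i => (numCycles g i : ℚ)) (charPoly (schur lam)) := by
  classical
  have hkm : k + (m - k) = m := by
    have := lam.2
    omega
  have h1 := pairing_complete_mul_monomial (r := m - k) (schur_mem lam)
    (σ := cycleExponent g) (by rw [cycleWeight_cycleExponent, hkm])
  have hmem : complete (m - k) * schur lam ∈ homogeneousPart m := by
    have := mul_mem_homogeneousPart (schur_mem lam) (complete_mem (m - k))
    rwa [hkm, mul_comm] at this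
  rw [eq_sum_schur hmem] at h1
  simp only [pairing_schur_complete_mul hkm, ite_smul, one_smul, zero_smul] at h1
  rw [← Finset.sum_filter, map_sum, LinearMap.sum_apply] at h1
  refine Eq.trans ?_ h1
  refine Finset.sum_bij (fun κ hκ => paddedDiagram κ m
    ((add_rowLen_le_of_isHorizontalStrip (mem_stripsBelow.1 hκ)).trans hm)) ?_ ?_ ?_ ?_
  · intro κ hκ
    exact Finset.mem_filter.2 ⟨Finset.mem_univ _,
      isHorizontalStrip_padded hm (mem_stripsBelow.1 hκ)
        ((add_rowLen_le_of_isHorizontalStrip (mem_stripsBelow.1 hκ)).trans hm)⟩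
  · intro κ _ κ' _ h
    exact paddedDiagram_injective h
  · intro ν hν
    obtain ⟨κ, h, hs, rfl⟩ := exists_eq_paddedDiagram (Finset.mem_filter.1 hν).2
    exact ⟨κ, mem_stripsBelow.2 hs, rfl⟩
  · intro κ hκ
    exact paddedCharacter_eq
      ((add_rowLen_le_of_isHorizontalStrip (mem_stripsBelow.1 hκ)).trans hm) g

theorem exists_characterPolynomial (lam : YoungDiagram) :
    ∃ q : MvPolynomial ℕ+ ℚ, ∀ m, lam.card + lam.rowLen 0 ≤ m → ∀ g : Equiv.Perm (Fin m),
      paddedCharacter lam m g = eval (fun i => (numCycles g i : ℚ)) q := by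
  classical
  induction hk : lam.card using Nat.strong_induction_on generalizing lam with
  | _ k ih =>
  have hlt : ∀ κ ∈ (stripsBelow lam).erase lam, κ.card < k := fun κ hκ => by
    rw [Finset.mem_erase, mem_stripsBelow] at hκ
    by_contra h
    exact hκ.1 (eq_of_isHorizontalStrip hκ.2 (by omega)).symm
  choose! q hq using fun κ (hκ : κ ∈ (stripsBelow lam).erase lam) => ih _ (hlt κ hκ) κ rfl
  refine ⟨charPoly (schur ⟨lam, rfl⟩) - ∑ κ ∈ (stripsBelow lam).erase lam, q κ,
    fun m hm g => ?_⟩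
  subst hk
  rw [map_sub, ← sum_paddedCharacter ⟨lam, rfl⟩ hm g, map_sum,
    ← Finset.add_sum_erase _ _ (self_mem_stripsBelow lam), add_sub_assoc, left_eq_add, sub_eq_zero]
  refine Finset.sum_congr rfl fun κ hκ => hq κ hκ m ?_ g
  exact (add_rowLen_le_of_isHorizontalStrip
    (mem_stripsBelow.1 (Finset.mem_of_mem_erase hκ))).trans hm

/-- The character polynomial of `V_{lam[m]}`. -/
noncomputable def characterPolynomial (lam : YoungDiagram) : MvPolynomial ℕ+ ℚ :=
  (exists_characterPolynomial lam).choose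

theorem traceOn_paddedSimple {lam : YoungDiagram} {m : ℕ} (hm : lam.card + lam.rowLen 0 ≤ m)
    (g : Equiv.Perm (Fin m)) : traceOn (paddedSimple lam m hm) (MonoidAlgebra.single g 1) =
      eval (fun i => (numCycles g i : ℚ)) (characterPolynomial lam) := by
  refine Eq.trans ?_ ((exists_characterPolynomial lam).choose_spec m hm g)
  rw [paddedCharacter, dif_pos hm]

theorem charPoly_schur {k : ℕ} (lam : Diagram k) :
    charPoly (schur lam) = ∑ κ ∈ stripsBelow lam.1, characterPolynomial κ := by
  refine eq_of_eval_numCycles_eq (lam.1.card + lam.1.rowLen 0) fun m hm g => ?_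
  rw [← sum_paddedCharacter lam hm, map_sum]
  refine Finset.sum_congr rfl fun κ hκ => ?_
  exact (exists_characterPolynomial κ).choose_spec m
    ((add_rowLen_le_of_isHorizontalStrip (mem_stripsBelow.1 hκ)).trans hm) g

/-- The span of the character polynomials of the diagrams with at most `d` cells. -/
noncomputable def characterSpan (d : ℕ) : Submodule ℚ (MvPolynomial ℕ+ ℚ) :=
  Submodule.span ℚ (Set.range fun κ : {κ : YoungDiagram // κ.card ≤ d} => characterPolynomial κ.1)

theorem characterSpan_mono : Monotone characterSpan := by
  intro a b hab
  refine Submodule.span_mono ?_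
  rintro _ ⟨κ, rfl⟩
  exact ⟨⟨κ.1, κ.2.trans hab⟩, rfl⟩

theorem charPoly_mem_characterSpan {k : ℕ} {F : MvPolynomial ℕ+ ℚ} (hF : F ∈ homogeneousPart k) :
    charPoly F ∈ characterSpan k := by
  rw [eq_sum_schur hF, map_sum]
  refine Submodule.sum_mem _ fun lam _ => ?_
  rw [map_smul, charPoly_schur]
  refine Submodule.smul_mem _ _ (Submodule.sum_mem _ fun κ hκ => Submodule.subset_span ?_)
  exact ⟨⟨κ, (card_le_of_isHorizontalStrip (mem_stripsBelow.1 hκ)).trans lam.2.le⟩, rfl⟩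

theorem fallingMonomial_mem_characterSpan (ρ : ℕ+ →₀ ℕ) :
    fallingMonomial ρ ∈ characterSpan (cycleWeight ρ) := by
  have := charPoly_mem_characterSpan (monomial_mem_homogeneousPart (σ := ρ) rfl 1)
  rwa [charPoly_monomial, one_smul] at this

/-- The span of the falling monomials of weight at most `d`. -/
noncomputable def fallingSpan (d : ℕ) : Submodule ℚ (MvPolynomial ℕ+ ℚ) :=
  Submodule.span ℚ {P | ∃ ρ, cycleWeight ρ ≤ d ∧ P = fallingMonomial ρ}

theorem fallingSpan_le_characterSpan (d : ℕ) : fallingSpan d ≤ characterSpan d := by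
  refine Submodule.span_le.2 ?_
  rintro _ ⟨ρ, hρ, rfl⟩
  exact characterSpan_mono hρ (fallingMonomial_mem_characterSpan ρ)

theorem X_mul_mem_fallingSpan {d : ℕ} {P : MvPolynomial ℕ+ ℚ} (hP : P ∈ fallingSpan d) (i : ℕ+) :
    X i * P ∈ fallingSpan (d + i) := by
  induction hP using Submodule.span_induction with
  | zero => simp
  | add x y _ _ hx hy =>
    rw [mul_add]
    exact Submodule.add_mem _ hx hy
  | smul a x _ hx =>
    rw [mul_smul_comm]
    exact Submodule.smul_mem _ _ hx
  | mem x hx =>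
    obtain ⟨ρ, hρ, rfl⟩ := hx
    have hi : ((i : ℕ) : ℚ) ≠ 0 := Nat.cast_ne_zero.2 i.pos.ne'
    have h1 : X i * fallingMonomial ρ = ((i : ℕ) : ℚ)⁻¹ •
        fallingMonomial (ρ + Finsupp.single i 1) + (ρ i : ℚ) • fallingMonomial ρ := by
      rw [fallingMonomial_add_single, smul_eq_C_mul, smul_eq_C_mul, ← mul_assoc, ← mul_assoc,
        ← C_mul, inv_mul_cancel₀ hi, C_1]
      ring
    rw [h1]
    refine Submodule.add_mem _ (Submodule.smul_mem _ _ (Submodule.subset_span ⟨_, ?_, rfl⟩))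
      (Submodule.smul_mem _ _ (Submodule.subset_span ⟨_, ?_, rfl⟩))
    · rw [map_add]
      simpa [Finsupp.weight_single] using hρ
    · omega

theorem monomial_mem_fallingSpan (σ : ℕ+ →₀ ℕ) :
    monomial σ 1 ∈ fallingSpan (cycleWeight σ) := by
  induction hn : cycleWeight σ using Nat.strong_induction_on generalizing σ with
  | _ n ih =>
  by_cases h0 : σ = 0
  · subst h0
    refine Submodule.subset_span ⟨0, by simp, ?_⟩
    simp [fallingMonomial]
  · obtain ⟨i, hi⟩ := Finsupp.support_nonempty_iff.2 h0
    have h1 : Finsupp.single i 1 ≤ σ := by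
      rw [Finsupp.single_le_iff]
      exact Nat.one_le_iff_ne_zero.2 (Finsupp.mem_support_iff.1 hi)
    have h2 := congrArg cycleWeight (tsub_add_cancel_of_le h1)
    rw [map_add, hn] at h2
    have h3 : cycleWeight (Finsupp.single i 1) = i := by simp [Finsupp.weight_single]
    rw [h3] at h2
    have h4 := X_mul_mem_fallingSpan (ih _ (by have := i.pos; omega) (σ - Finsupp.single i 1) rfl) i
    rw [X, monomial_mul, one_mul, add_tsub_cancel_of_le h1, h2] at h4
    exact h4

theorem mem_characterSpan (P : MvPolynomial ℕ+ ℚ) : P ∈ characterSpan (weight P) := by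
  rw [P.as_sum]
  refine Submodule.sum_mem _ fun σ hσ => ?_
  rw [← P.as_sum]
  have h1 : monomial σ (coeff σ P) = coeff σ P • monomial σ (1 : ℚ) := by simp [smul_monomial]
  rw [h1]
  refine Submodule.smul_mem _ _ (characterSpan_mono (le_weightedTotalDegree _ hσ) ?_)
  exact fallingSpan_le_characterSpan _ (monomial_mem_fallingSpan σ)

end Padded

end SymmetricRep

namespace SymmetricRep

/-! ### Modules determined by primitive idempotents -/

section Isotypic

variable {G : Type*} [Group G] [Fintype G]

theorem traceOn_pi {ι : Type*} [Fintype ι] (M : ι → Type*) [∀ i, AddCommGroup (M i)]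
    [∀ i, Module ℚ (M i)] [∀ i, Module (MonoidAlgebra ℚ G) (M i)]
    [∀ i, IsScalarTower ℚ (MonoidAlgebra ℚ G) (M i)] [∀ i, Module.Finite ℚ (M i)]
    (x : MonoidAlgebra ℚ G) : traceOn (∀ i, M i) x = ∑ i, traceOn (M i) x := by
  classical
  have h1 : Algebra.lsmul ℚ ℚ (∀ i, M i) x = ∑ i, LinearMap.single ℚ M i ∘ₗ
      (Algebra.lsmul ℚ ℚ (M i) x ∘ₗ LinearMap.proj i) := by
    ext i y j
    by_cases h : j = i
    · subst h
      simp [Finset.sum_apply]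
    · simp [Finset.sum_apply, h]
  rw [traceOn_apply, h1, map_sum]
  refine Finset.sum_congr rfl fun i _ => ?_
  rw [LinearMap.trace_comp_comm', traceOn_apply]
  congr 1
  ext y
  simp

theorem injective_of_primitive_idempotents {ι : Type*} [Fintype ι] {e : ι → MonoidAlgebra ℚ G}
    {I : ι → Submodule (MonoidAlgebra ℚ G) (MonoidAlgebra ℚ G)}
    (hI : ∀ i, ∀ x ∈ I i, x * e i = x)
    (horth : ∀ i j, i ≠ j → ∀ x, e i * x * e j = 0)
    (hprim : ∀ i x, ∃ a : ℚ, e i * x * e i = a • e i)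
    {M : Type*} [AddCommGroup M] [Module ℚ M] [Module (MonoidAlgebra ℚ G) M]
    [IsScalarTower ℚ (MonoidAlgebra ℚ G) M] {n : ι → ℕ}
    {b : ∀ i, Fin (n i) → M} (hb : ∀ i l, e i • b i l = b i l)
    (hli : ∀ i, LinearIndependent ℚ (b i)) {f : ∀ i, Fin (n i) → I i}
    (hf : ∑ i, ∑ l, ((f i l : MonoidAlgebra ℚ G)) • b i l = 0) : f = 0 := by
  by_contra hne
  obtain ⟨i, hi⟩ := Function.ne_iff.1 hne
  obtain ⟨l, hl⟩ := Function.ne_iff.1 hi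
  set x : MonoidAlgebra ℚ G := (f i l : MonoidAlgebra ℚ G) with hx
  have hx0 : x ≠ 0 := fun h => hl (Subtype.ext h)
  have hyx := mul_inversion_mul_ne_zero hx0 (hI i x (f i l).2)
  set y := e i * inversion x with hy
  have hz : ∀ l', ∃ a : ℚ, y * (f i l' : MonoidAlgebra ℚ G) = a • e i := fun l' => by
    obtain ⟨a, ha⟩ := hprim i (inversion x * (f i l' : MonoidAlgebra ℚ G))
    refine ⟨a, ?_⟩
    rw [← ha, hy, mul_assoc, mul_assoc, mul_assoc, hI i _ (f i l').2]
  choose a ha using hz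
  have h1 := congrArg (fun v => y • v) hf
  simp only [smul_zero, Finset.smul_sum, smul_smul] at h1
  rw [Finset.sum_eq_single i] at h1
  · have h2 : ∑ l', a l' • b i l' = 0 := by
      rw [← h1]
      refine Finset.sum_congr rfl fun l' _ => ?_
      rw [ha, smul_assoc, hb]
    have h3 := Fintype.linearIndependent_iff.1 (hli i) a h2 l
    have h4 := ha l
    rw [h3, zero_smul] at h4
    exact hyx h4
  · intro j _ hj
    refine Finset.sum_eq_zero fun l' _ => ?_
    have : y * (f j l' : MonoidAlgebra ℚ G) = 0 := by
      rw [hy, ← hI j _ (f j l').2, mul_assoc, ← mul_assoc (inversion x), ← mul_assoc,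
        horth i j (Ne.symm hj)]
    rw [this, zero_smul]
  · simp

open DirectSum in
theorem nonempty_equiv_of_primitive_idempotents {ι : Type*} [Fintype ι]
    {e : ι → MonoidAlgebra ℚ G} (he : ∀ i, e i * e i = e i)
    {I : ι → Submodule (MonoidAlgebra ℚ G) (MonoidAlgebra ℚ G)}
    (hI : ∀ i, I i = Submodule.span (MonoidAlgebra ℚ G) {e i})
    (horth : ∀ i j, i ≠ j → ∀ x, e i * x * e j = 0)
    (hprim : ∀ i x, ∃ a : ℚ, e i * x * e i = a • e i)
    {M : Type*} [AddCommGroup M] [Module ℚ M] [Module (MonoidAlgebra ℚ G) M]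
    [IsScalarTower ℚ (MonoidAlgebra ℚ G) M] [Module.Finite ℚ M] {n : ι → ℕ}
    (hn : ∀ i, traceOn M (e i) = n i)
    (hdim : traceOn M (1 : MonoidAlgebra ℚ G) = ∑ i, n i * traceOn (I i) (1 : MonoidAlgebra ℚ G)) :
    Nonempty (M ≃ₗ[MonoidAlgebra ℚ G] ⨁ i, (Fin (n i) → I i)) := by
  classical
  have hrank : ∀ i, Module.finrank ℚ (LinearMap.range (Algebra.lsmul ℚ ℚ M (e i))) = n i :=
    fun i => by
      have := hn i
      rw [traceOn_idempotent (he i)] at this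
      exact_mod_cast this
  let B := fun i => Module.finBasisOfFinrankEq ℚ
    (LinearMap.range (Algebra.lsmul ℚ ℚ M (e i))) (hrank i)
  let b : ∀ i, Fin (n i) → M := fun i l => (B i l : M)
  have hb : ∀ i l, e i • b i l = b i l := fun i l => by
    obtain ⟨w, hw⟩ := (B i l).2
    change e i • (B i l : M) = (B i l : M)
    rw [← hw, Algebra.lsmul_coe, smul_smul, he]
  have hli : ∀ i, LinearIndependent ℚ (b i) := fun i =>
    (B i).linearIndependent.map' (Submodule.subtype _) (Submodule.ker_subtype _)
  let Φ : (∀ i, Fin (n i) → I i) →ₗ[MonoidAlgebra ℚ G] M :=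
    ∑ i, ∑ l, (LinearMap.toSpanSingleton (MonoidAlgebra ℚ G) M (b i l)) ∘ₗ (I i).subtype ∘ₗ
      LinearMap.proj l ∘ₗ LinearMap.proj i
  have hΦ : ∀ f, Φ f = ∑ i, ∑ l, ((f i l : MonoidAlgebra ℚ G)) • b i l := fun f => by
    simp [Φ, LinearMap.sum_apply]
  have hinj : Function.Injective Φ := by
    rw [injective_iff_map_eq_zero]
    intro f hf
    rw [hΦ] at hf
    refine injective_of_primitive_idempotents (fun i x hx => ?_) horth hprim hb hli hf
    rw [hI] at hx
    exact (mem_span_idempotent (he i)).1 hx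
  have hfin : Module.finrank ℚ (∀ i, Fin (n i) → I i) = Module.finrank ℚ M := by
    have h1 : traceOn (∀ i, Fin (n i) → I i) (1 : MonoidAlgebra ℚ G) =
        traceOn M (1 : MonoidAlgebra ℚ G) := by
      rw [hdim, traceOn_pi]
      refine Finset.sum_congr rfl fun i _ => ?_
      rw [traceOn_pi]
      simp
    have h2 : traceOn M (1 : MonoidAlgebra ℚ G) = Module.finrank ℚ M := by
      rw [traceOn_apply, map_one, LinearMap.trace_one]
    have h3 : traceOn (∀ i, Fin (n i) → I i) (1 : MonoidAlgebra ℚ G) =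
        Module.finrank ℚ (∀ i, Fin (n i) → I i) := by
      rw [traceOn_apply, map_one, LinearMap.trace_one]
    rw [h2, h3] at h1
    exact_mod_cast h1
  have hsurj : Function.Surjective (Φ.restrictScalars ℚ) :=
    (LinearMap.injective_iff_surjective_of_finrank_eq_finrank hfin).1 hinj
  exact ⟨(LinearEquiv.ofBijective Φ ⟨hinj, hsurj⟩).symm.trans
    (DirectSum.linearEquivFunOnFintype (MonoidAlgebra ℚ G) ι fun i => Fin (n i) → I i).symm⟩

theorem traceOn_asModule {V : Type*} [AddCommGroup V] [Module ℚ V] (ρ : Representation ℚ G V)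
    (g : G) : traceOn ρ.asModule (MonoidAlgebra.single g 1) = ρ.character g := by
  rw [traceOn_apply, Representation.character, ← LinearMap.trace_conj' _ ρ.asModuleEquiv]
  congr 1
  ext y
  change ρ.asModuleEquiv (MonoidAlgebra.single g (1 : ℚ) • ρ.asModuleEquiv.symm y) = ρ g y
  rw [Representation.asModuleEquiv_map_smul, Representation.asAlgebraHom_single,
    LinearEquiv.apply_symm_apply, one_smul]

end Isotypic

end SymmetricRep

open SymmetricRep MvPolynomial

namespace FBModule

variable (W : FBModule.{u})

noncomputable instance (N : ℕ) :
    Fintype {lam : YoungDiagram // lam.card + lam.rowLen 0 ≤ N} :=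
  have := finite_diagrams N
  have : Finite {lam : YoungDiagram // lam.card + lam.rowLen 0 ≤ N} := Finite.of_injective
    (fun lam => (⟨lam.1, (Nat.le_add_right _ _).trans lam.2⟩ : {μ : YoungDiagram // μ.card ≤ N}))
    fun _ _ h => Subtype.ext (congrArg (fun x => x.1) h)
  Fintype.ofFinite _

variable {W}

theorem PCFrom_of_RSFrom {N : ℕ} (h : W.RSFrom N) : W.PCFrom N := by
  obtain ⟨n, hn⟩ := h
  refine ⟨∑ lam, (n lam : ℚ) • characterPolynomial lam.1, fun m hm g => ?_⟩
  obtain ⟨φ⟩ := hn m hm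
  rw [← traceOn_asModule, traceOn_congr (φ.trans (DirectSum.linearEquivFunOnFintype _ _ _)),
    traceOn_pi, map_sum]
  refine Finset.sum_congr rfl fun lam _ => ?_
  rw [traceOn_pi, smul_eval, ← traceOn_paddedSimple (lam.2.trans hm)]
  simp

theorem exists_eq_sum_characterPolynomial (P : MvPolynomial ℕ+ ℚ) {N : ℕ}
    (hN : 2 * weight P ≤ N) :
    ∃ c : {lam : YoungDiagram // lam.card + lam.rowLen 0 ≤ N} → ℚ,
      P = ∑ lam, c lam • characterPolynomial lam.1 := by
  have h1 : characterSpan (weight P) ≤ Submodule.span ℚ (Set.range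
      fun lam : {lam : YoungDiagram // lam.card + lam.rowLen 0 ≤ N} =>
        characterPolynomial lam.1) := by
    refine Submodule.span_mono ?_
    rintro _ ⟨κ, rfl⟩
    have h2 : κ.1.rowLen 0 ≤ κ.1.card := by
      rw [YoungDiagram.rowLen_eq_card]
      exact Finset.card_le_card (Finset.filter_subset _ _)
    have h3 := κ.2
    exact ⟨⟨κ.1, by omega⟩, rfl⟩
  obtain ⟨c, hc⟩ := (Submodule.mem_span_range_iff_exists_fun ℚ).1 (h1 (mem_characterSpan P))
  exact ⟨c, hc.symm⟩

theorem RSFrom_of_characterEqFrom {P : MvPolynomial ℕ+ ℚ} {N : ℕ} (h : W.CharacterEqFrom P N)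
    (hN : 2 * weight P ≤ N) : W.RSFrom N := by
  classical
  obtain ⟨c, hc⟩ := exists_eq_sum_characterPolynomial P hN
  have htrace : ∀ m (hm : N ≤ m) (x : GroupAlg m), traceOn (W.ρ m).asModule x =
      ∑ lam, c lam * traceOn (paddedSimple lam.1 m (lam.2.trans hm)) x := by
    intro m hm x
    rw [eq_sum_single x]
    simp only [map_sum, map_smul, smul_eq_mul, Finset.mul_sum]
    rw [Finset.sum_comm]
    refine Finset.sum_congr rfl fun g _ => ?_
    rw [traceOn_asModule, h m hm g, hc, map_sum, Finset.mul_sum]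
    refine Finset.sum_congr rfl fun lam _ => ?_
    rw [smul_eval, traceOn_paddedSimple (lam.2.trans hm)]
    ring
  have hne : ∀ m (hm : N ≤ m) (lam κ : {lam : YoungDiagram // lam.card + lam.rowLen 0 ≤ N}),
      lam ≠ κ → padded lam.1 m (lam.2.trans hm) ≠ padded κ.1 m (κ.2.trans hm) :=
    fun m hm lam κ hlk heq => hlk (Subtype.ext (paddedDiagram_injective
      (h := lam.2.trans hm) (h' := κ.2.trans hm) (Subtype.ext heq)))
  have hmult : ∀ m (hm : N ≤ m) lam, traceOn (W.ρ m).asModule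
      (youngIdempotent (padded lam.1 m (lam.2.trans hm)) (card_padded _ _ _)) = c lam := by
    intro m hm lam
    rw [htrace m hm, Finset.sum_eq_single lam, traceOn_simpleModule_self, mul_one]
    · intro κ _ hκ
      rw [traceOn_simpleModule_of_ne (hne m hm lam κ (Ne.symm hκ)), mul_zero]
    · simp
  have hnat : ∀ lam, ∃ n : ℕ, c lam = n := fun lam => by
    rw [← hmult N le_rfl lam, traceOn_idempotent (youngIdempotent_mul_self _ _)]
    exact ⟨_, rfl⟩
  choose n hn using hnat
  refine ⟨n, fun m hm => ?_⟩
  have hprim := fun (lam : {lam : YoungDiagram // lam.card + lam.rowLen 0 ≤ N}) x =>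
    exists_youngIdempotent_mul_mul (μ := padded lam.1 m (lam.2.trans hm))
      (h := card_padded lam.1 m (lam.2.trans hm)) x
  have horth := fun (lam κ : {lam : YoungDiagram // lam.card + lam.rowLen 0 ≤ N}) hlk x =>
    youngIdempotent_mul_mul_eq_zero (h := card_padded lam.1 m (lam.2.trans hm))
      (h' := card_padded κ.1 m (κ.2.trans hm)) (hne m hm lam κ hlk) x
  have hidem := fun (lam : {lam : YoungDiagram // lam.card + lam.rowLen 0 ≤ N}) =>
    youngIdempotent_mul_self (padded lam.1 m (lam.2.trans hm))
      (card_padded lam.1 m (lam.2.trans hm))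
  have hI := fun (lam : {lam : YoungDiagram // lam.card + lam.rowLen 0 ≤ N}) =>
    simpleModule_eq (padded lam.1 m (lam.2.trans hm)) (card_padded lam.1 m (lam.2.trans hm))
  have hdim := htrace m hm 1
  simp only [hn] at hdim
  exact nonempty_equiv_of_primitive_idempotents hidem hI horth hprim
    (fun lam => (hmult m hm lam).trans (hn lam)) hdim

end FBModule

theorem theorem4p1p1 (W : FBModule.{u}) :
    (W.RS → W.PC ∧ W.rankPC ≤ W.rankRS) ∧
    (∀ P : MvPolynomial ℕ+ ℚ, W.IsPolynomialCharacter P →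
      W.RS ∧ W.rankRS ≤ max W.rankPC (2 * SymmetricRep.weight P)) := by
  constructor
  · intro h
    have h1 : W.PCFrom W.rankRS := FBModule.PCFrom_of_RSFrom (Nat.sInf_mem h)
    exact ⟨⟨_, h1⟩, Nat.sInf_le h1⟩
  · rintro P ⟨M, hM⟩
    obtain ⟨Q, hQ⟩ : W.PCFrom W.rankPC := Nat.sInf_mem (s := {N | W.PCFrom N}) ⟨M, P, hM⟩
    obtain rfl : P = Q := eq_of_eval_numCycles_eq (max M W.rankPC) fun m hm g => by
      rw [← hM m ((le_max_left _ _).trans hm) g, hQ m ((le_max_right _ _).trans hm) g]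
    have h1 : W.RSFrom (max W.rankPC (2 * SymmetricRep.weight P)) :=
      FBModule.RSFrom_of_characterEqFrom (fun m hm g => hQ m ((le_max_left _ _).trans hm) g)
        (le_max_right _ _)
    exact ⟨⟨_, h1⟩, Nat.sInf_le h1⟩
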